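/- Theorem 1 (thm:ARNPG-IMD). Consider a finite discounted Markov decision process with finite state space $\mathcal S$, finite action space $\mathcal A$ with $|\mathcal A|\ge 2$, transition kernel $P$, arbitrary initial distribution $\rho$, discount factor $\gamma\in(0,1)$ and reward functions $r_1,\dots,r_m:\mathcal S\times\mathcal A\to[0,1]$. For a stationary policy $\pi$ and a reward $r$ let $V_r^\pi(\rho)=\mathbb E[\sum_{t\ge0}\gamma^t r(s_t,a_t)]$ with $s_0\sim\rho$, $V^\pi_{1:m}(\rho)=(V^\pi_{r_1}(\rho),\dots,V^\pi_{r_m}(\rho))\in[0,\frac1{1-\gamma}]^m$, and $d_\rho^\pi(s,a)=(1-\gamma)\sum_{t\ge0}\gamma^t\,\mathbb P(s_t=s,a_t=a)$, $d_\rho^\pi(s)=\sum_a d_\rho^\pi(s,a)$. For $\theta\in\mathbb R^{\mathcal S\times\mathcal A}$ let $\pi_\theta(a|s)=e^{\theta_{s,a}}/\sum_{a'}e^{\theta_{s,a'}}$ be the softmax policy. Let $F:[0,\frac1{1-\gamma}]^m\to\mathbb R$ be concave and $\beta$-smooth with respect to $\|\cdot\|_\infty$ with $\beta>0$, i.e.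 $F$ is differentiable and $\|\nabla F(v)-\nabla F(v')\|_1\le\beta\|v-v'\|_\infty$ for all $v,v'$, and let $L>0$ be such that $\|\nabla F(v)\|_1\le L$ for every value vector $v$ of a softmax policy. ARNPG-IMD with parameters $\alpha,\eta,t_0,\dots,t_{K-1}$ starts at $\theta_0$ and, for $k=0,\dots,K-1$, sets $\tilde r_k(s,a)=\langle\nabla F(V^{\pi_{\theta_k}}_{1:m}(\rho)),r_{1:m}(s,a)\rangle$ and obtains $\theta_{k+1}$ from $\theta_k$ by $t_k$ natural policy gradient steps $$\theta\leftarrow\theta+\eta\,\mathcal F_\rho(\theta)^\dagger\,\nabla_\theta\Big[V^{\pi_\theta}_{\tilde r_k}(\rho)-\frac{\alpha}{1-\gamma}\sum_s d^{\pi_\theta}_\rho(s)\sum_a\pi_\theta(a|s)\log\frac{\pi_\theta(a|s)}{\pi_{\theta_k}(a|s)}\Big],$$ where $\mathcal F_\rho(\theta)^\dagger$ is the Moore–Penrose inverse of the Fisher information matrix $\mathcal F_\rho(\theta)=\mathbb E_{(s,a)\sim d_\rho^{\pi_\theta}}[\nabla_\theta\log\pi_\theta(a|s)\,(\nabla_\theta\log\pi_\theta(a|s))^\top]$.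 Write $\pi_k=\pi_{\theta_k}$. For any $K\ge1$, take $\pi_0$ uniform, $\alpha\ge\frac{\beta}{(1-\gamma)^3}$, $\eta=\frac{1-\gamma}{\alpha}$ and $t_k=\big\lceil\frac1{1-\gamma}\log\big(\frac{5LK}{\beta\log|\mathcal A|}\big)+1\big\rceil$ for all $k$ (read as $0$ if this integer is negative). Then there is a stationary policy maximizing $F(V^\pi_{1:m}(\rho))$ over all stationary policies $\pi$, and every such maximizer $\pi^*$ satisfies $$F(V^{\pi^*}_{1:m}(\rho))-\max_{1\le k\le K}F(V^{\pi_k}_{1:m}(\rho))\;\le\;F(V^{\pi^*}_{1:m}(\rho))-\frac1K\sum_{k=1}^KF(V^{\pi_k}_{1:m}(\rho))\;\le\;\frac{2\alpha\log|\mathcal A|}{(1-\gamma)K}.$$ -/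

import Mathlib

open scoped BigOperators

/-- `B` is a Moore--Penrose inverse of the real square matrix `A` (the four Penrose equations). -/
def IsMoorePenrose {ι : Type*} [Fintype ι] (A B : Matrix ι ι ℝ) : Prop :=
  A * B * A = A ∧ B * A * B = B ∧ (A * B).transpose = A * B ∧ (B * A).transpose = B * A

/-- The Moore--Penrose inverse is unique. -/
theorem IsMoorePenrose.unique {ι : Type*} [Fintype ι] {A B C : Matrix ι ι ℝ}
    (hB : IsMoorePenrose A B) (hC : IsMoorePenrose A C) : B = C := by
  obtain ⟨b1, b2, b3, b4⟩ := hB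
  obtain ⟨c1, c2, c3, c4⟩ := hC
  have h1 : A * B = A * C := by
    calc A * B = (A * B).transpose := b3.symm
      _ = ((A * C) * (A * B)).transpose := by
          rw [← Matrix.mul_assoc, c1]
      _ = (A * B) * (A * C) := by rw [Matrix.transpose_mul, b3, c3]
      _ = A * C := by rw [← Matrix.mul_assoc, b1]
  have h2 : B * A = C * A := by
    calc B * A = (B * A).transpose := b4.symm
      _ = ((B * A) * (C * A)).transpose := by
          rw [Matrix.mul_assoc B A (C * A), ← Matrix.mul_assoc A C A, c1]
      _ = (C * A) * (B * A) := by rw [Matrix.transpose_mul, b4, c4]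
      _ = C * A := by rw [Matrix.mul_assoc C A (B * A), ← Matrix.mul_assoc A B A, b1]
  calc B = B * A * B := b2.symm
    _ = C * A * B := by rw [h2]
    _ = C * A * C := by rw [Matrix.mul_assoc, h1, Matrix.mul_assoc]
    _ = C := c2

/-- Every real symmetric matrix has a Moore--Penrose inverse. -/
theorem exists_isMoorePenrose {ι : Type*} [Fintype ι] [DecidableEq ι] {A : Matrix ι ι ℝ}
    (hA : A.IsHermitian) : ∃ B : Matrix ι ι ℝ, IsMoorePenrose A B := by
  obtain ⟨U, D, hU, hAD⟩ : ∃ (U : Matrix ι ι ℝ) (D : ι → ℝ), U.transpose * U = 1 ∧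
      A = U * Matrix.diagonal D * U.transpose := by
    refine ⟨(hA.eigenvectorUnitary : Matrix ι ι ℝ), hA.eigenvalues, ?_, ?_⟩
    · have h := Unitary.coe_star_mul_self hA.eigenvectorUnitary
      rwa [Matrix.star_eq_conjTranspose, Matrix.conjTranspose_eq_transpose_of_trivial] at h
    · have h := hA.spectral_theorem
      rw [Unitary.conjStarAlgAut_apply, Matrix.star_eq_conjTranspose,
        Matrix.conjTranspose_eq_transpose_of_trivial] at h
      exact h
  have key : ∀ X Y : ι → ℝ, (U * Matrix.diagonal X * U.transpose) *
      (U * Matrix.diagonal Y * U.transpose) =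
      U * Matrix.diagonal (fun i => X i * Y i) * U.transpose := by
    intro X Y
    calc (U * Matrix.diagonal X * U.transpose) * (U * Matrix.diagonal Y * U.transpose)
        = U * Matrix.diagonal X * (U.transpose * U) * Matrix.diagonal Y * U.transpose := by
          simp only [Matrix.mul_assoc]
      _ = _ := by
          rw [hU, Matrix.mul_one, Matrix.mul_assoc U, Matrix.diagonal_mul_diagonal]
  have tr : ∀ X : ι → ℝ, (U * Matrix.diagonal X * U.transpose).transpose =
      U * Matrix.diagonal X * U.transpose := by
    intro X
    simp [Matrix.transpose_mul, Matrix.mul_assoc]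
  refine ⟨U * Matrix.diagonal (fun i => (D i)⁻¹) * U.transpose, ?_⟩
  subst hAD
  refine ⟨?_, ?_, ?_, ?_⟩
  · simp only [key]
    congr 3
    funext i
    exact mul_inv_mul_cancel (D i)
  · simp only [key]
    congr 3
    funext i
    by_cases h : D i = 0 <;> simp [h]
  · rw [key, tr]
  · rw [key, tr]

open Classical in
/-- The Moore--Penrose inverse (it exists and is unique for symmetric matrices). -/
noncomputable def moorePenrose {ι : Type*} [Fintype ι] (A : Matrix ι ι ℝ) : Matrix ι ι ℝ :=
  if h : ∃ B : Matrix ι ι ℝ, IsMoorePenrose A B then h.choose else 0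

/-- The defining property of `moorePenrose` on symmetric matrices. -/
theorem moorePenrose_spec {ι : Type*} [Fintype ι] [DecidableEq ι] {A : Matrix ι ι ℝ}
    (hA : A.IsHermitian) : IsMoorePenrose A (moorePenrose A) := by
  unfold moorePenrose
  rw [dif_pos (exists_isMoorePenrose hA)]
  exact (exists_isMoorePenrose hA).choose_spec

/-- The vector of partial derivatives of `f` at `θ`. -/
noncomputable def partials {ι : Type*} [Fintype ι] [DecidableEq ι]
    (f : (ι → ℝ) → ℝ) (θ : ι → ℝ) : ι → ℝ :=
  fun i => fderiv ℝ f θ (Pi.single i 1)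

/-- The box `[0, 1/(1-γ)]^m`, which contains all value vectors. -/
def valueBox (m : ℕ) (γ : ℝ) : Set (Fin m → ℝ) :=
  Set.Icc (fun _ => 0) (fun _ => 1 / (1 - γ))

/-- The gradient `∇F(v)` of a function `F` given on the box `[0, 1/(1-γ)]^m`
(one-sided partial derivatives are used at the boundary of the box). -/
noncomputable def gradF {m : ℕ} (γ : ℝ) (F : (Fin m → ℝ) → ℝ) (v : Fin m → ℝ) : Fin m → ℝ :=
  fun i => fderivWithin ℝ F (valueBox m γ) v (Pi.single i 1)

/-- `F` is `β`-smooth with respect to `‖·‖_∞` on the box: it is differentiable and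
`‖∇F(v) - ∇F(w)‖₁ ≤ β ‖v - w‖_∞`.  The norm of `Fin m → ℝ` is the sup norm. -/
def IsSmoothWrtSup {m : ℕ} (γ β : ℝ) (F : (Fin m → ℝ) → ℝ) : Prop :=
  DifferentiableOn ℝ F (valueBox m γ) ∧
    ∀ v ∈ valueBox m γ, ∀ w ∈ valueBox m γ,
      ∑ i, |gradF γ F v i - gradF γ F w i| ≤ β * ‖v - w‖

/-- A stationary policy `π : S → Δ(A)`. -/
def IsPolicy {S A : Type*} [Fintype A] (π : S → A → ℝ) : Prop :=
  ∀ s, π s ∈ stdSimplex ℝ A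

/-- The softmax policy `π_θ(a|s) = exp θ_{s,a} / ∑_{a'} exp θ_{s,a'}`. -/
noncomputable def softmax {S A : Type*} [Fintype A] (θ : S × A → ℝ) (s : S) (a : A) : ℝ :=
  Real.exp (θ (s, a)) / ∑ a', Real.exp (θ (s, a'))

/-- The Kullback--Leibler divergence of two probability vectors. -/
noncomputable def klVec {A : Type*} [Fintype A] (x y : A → ℝ) : ℝ :=
  ∑ a, x a * Real.log (x a / y a)

/-- `D_d(π ‖ π') = ∑_s d(s) D(π(·|s) ‖ π'(·|s))`. -/
noncomputable def policyKL {S A : Type*} [Fintype S] [Fintype A]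
    (d : S → ℝ) (π π' : S → A → ℝ) : ℝ :=
  ∑ s, d s * klVec (π s) (π' s)

/-- A finite discounted Markov decision process with `m` reward functions in `[0,1]`. -/
structure MOMDP (S A : Type*) [Fintype S] [Fintype A] (m : ℕ) where
  /-- transition kernel, `P s a s'` is the probability of moving to `s'` -/
  P : S → A → S → ℝ
  P_mem : ∀ s a, P s a ∈ stdSimplex ℝ S
  /-- initial state distribution -/
  ρ : S → ℝ
  ρ_mem : ρ ∈ stdSimplex ℝ S
  /-- discount factor -/
  γ : ℝ
  γ_pos : 0 < γ
  γ_lt_one : γ < 1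
  /-- reward functions -/
  r : Fin m → S → A → ℝ
  r_mem : ∀ i s a, r i s a ∈ Set.Icc (0 : ℝ) 1

namespace MOMDP

variable {S A : Type*} [Fintype S] [Fintype A] {m : ℕ}

/-- `stateProb π t s` is the probability that `s_t = s` when `s_0 ∼ ρ`, `a_t ∼ π(·|s_t)` and
`s_{t+1} ∼ P(·|s_t,a_t)`. -/
def stateProb (M : MOMDP S A m) (π : S → A → ℝ) : ℕ → S → ℝ
  | 0 => M.ρ
  | t + 1 => fun s' => ∑ s, ∑ a, M.stateProb π t s * π s a * M.P s a s'

/-- The value `V_r^π(ρ) = E[∑_t γ^t r(s_t,a_t)]`, `s_0 ∼ ρ`, for a (real-valued) reward `r`. -/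
noncomputable def value (M : MOMDP S A m) (r : S → A → ℝ) (π : S → A → ℝ) : ℝ :=
  ∑' t : ℕ, M.γ ^ t * ∑ s, ∑ a, M.stateProb π t s * π s a * r s a

/-- The value vector `V_{1:m}^π(ρ)`. -/
noncomputable def valueVec (M : MOMDP S A m) (π : S → A → ℝ) : Fin m → ℝ :=
  fun i => M.value (M.r i) π

/-- The achievable region of value vectors of softmax policies. -/
def achievable (M : MOMDP S A m) : Set (Fin m → ℝ) :=
  Set.range fun θ : S × A → ℝ => M.valueVec (softmax θ)

/-- The discounted state-action visitation distribution
`d_ρ^π(s,a) = (1-γ) ∑_t γ^t P(s_t = s, a_t = a)`. -/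
noncomputable def saVisit (M : MOMDP S A m) (π : S → A → ℝ) (s : S) (a : A) : ℝ :=
  (1 - M.γ) * ∑' t : ℕ, M.γ ^ t * (M.stateProb π t s * π s a)

/-- The discounted state visitation distribution, the marginal of `saVisit`. -/
noncomputable def stateVisit (M : MOMDP S A m) (π : S → A → ℝ) (s : S) : ℝ :=
  ∑ a, M.saVisit π s a

/-- The KL-regularized value with anchor policy `π₀`:
`V_r^π(ρ) - α D_{d_ρ^π}(π ‖ π₀) / (1-γ)`. -/
noncomputable def regValue (M : MOMDP S A m) (r : S → A → ℝ) (π₀ : S → A → ℝ) (α : ℝ)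
    (π : S → A → ℝ) : ℝ :=
  M.value r π - α * (policyKL (M.stateVisit π) π π₀ / (1 - M.γ))

/-- The Fisher information matrix
`E_{(s,a) ∼ d_ρ^{π_θ}} [∇_θ log π_θ(a|s) (∇_θ log π_θ(a|s))ᵀ]`. -/
noncomputable def fisher [DecidableEq S] [DecidableEq A] (M : MOMDP S A m) (θ : S × A → ℝ) :
    Matrix (S × A) (S × A) ℝ :=
  ∑ s, ∑ a, M.saVisit (softmax θ) s a •
    Matrix.vecMulVec (partials (fun θ' => Real.log (softmax θ' s a)) θ)
      (partials (fun θ' => Real.log (softmax θ' s a)) θ)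

/-- The Fisher information matrix is symmetric, so that its Moore--Penrose inverse exists. -/
theorem fisher_isHermitian [DecidableEq S] [DecidableEq A] (M : MOMDP S A m) (θ : S × A → ℝ) :
    (M.fisher θ).IsHermitian := by
  ext i j
  simp [fisher, Matrix.sum_apply, Matrix.vecMulVec_apply, mul_comm]

/-- One natural policy gradient step on the KL-regularized value with anchor `π₀`. -/
noncomputable def npgStep [DecidableEq S] [DecidableEq A] (M : MOMDP S A m) (r : S → A → ℝ)
    (π₀ : S → A → ℝ) (α η : ℝ) (θ : S × A → ℝ) : S × A → ℝ :=
  θ + η • (moorePenrose (M.fisher θ)).mulVec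
    (partials (fun θ' => M.regValue r π₀ α (softmax θ')) θ)

/-- The inner loop: `t` natural policy gradient steps started at the anchor parameter `θ`. -/
noncomputable def innerLoop [DecidableEq S] [DecidableEq A] (M : MOMDP S A m) (r : S → A → ℝ)
    (θ : S × A → ℝ) (α η : ℝ) (t : ℕ) : S × A → ℝ :=
  (M.npgStep r (softmax θ) α η)^[t] θ

/-- The reward in the ascent direction, `⟨∇F(V_{1:m}^π(ρ)), r_{1:m}(s,a)⟩`. -/
noncomputable def ascentReward (M : MOMDP S A m) (F : (Fin m → ℝ) → ℝ) (π : S → A → ℝ)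
    (s : S) (a : A) : ℝ :=
  ∑ i, gradF M.γ F (M.valueVec π) i * M.r i s a

/-- The parameters `θ_0, θ_1, …` produced by ARNPG implicit mirror descent with `t k` micro steps
in macro step `k`. -/
noncomputable def arnpgIMD [DecidableEq S] [DecidableEq A] (M : MOMDP S A m)
    (F : (Fin m → ℝ) → ℝ) (α η : ℝ) (t : ℕ → ℕ) (θ₀ : S × A → ℝ) : ℕ → (S × A → ℝ)
  | 0 => θ₀
  | k + 1 =>
      M.innerLoop (M.ascentReward F (softmax (M.arnpgIMD F α η t θ₀ k)))
        (M.arnpgIMD F α η t θ₀ k) α η (t k)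

/-- `π` is an optimal policy for the maximization of `F(V_{1:m}^π(ρ))` over stationary policies
(the closure of the softmax policies). -/
def IsOptimal (M : MOMDP S A m) (F : (Fin m → ℝ) → ℝ) (π : S → A → ℝ) : Prop :=
  IsPolicy π ∧ ∀ π' : S → A → ℝ, IsPolicy π' → F (M.valueVec π') ≤ F (M.valueVec π)

end MOMDP

/-! Each macro step is an approximate mirror ascent step whose divergence is the KL divergence
weighted by a visitation distribution. Concavity puts `F` below its linearization at the current
policy, and that linearization is the value for the ascent reward (`le_add_value_ascentReward`).
Conversely, squared differences of value vectors are bounded by KL (`sq_norm_valueVec_sub_le`), so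
smoothness and the lower bound on `α` keep the KL-regularized linearization below `F`
(`add_regValue_ascentReward_le`).

Between these two bounds sits a three-point inequality: the inner loop nearly maximizes the
regularized linearization, and any competitor `ν` loses a further multiple of its KL divergence to
the new policy (`regValue_innerLoop_ge`). For optimal `ν`, the gap after a macro step is then at
most `α / (1 - γ)` times the decrease of the divergence from `ν`, plus an inner-loop error
(`sub_le_of_innerLoop`). The weights are the visitation distribution of the fixed `ν`, so the sum
over `k` telescopes. The initial divergence is at most `log |A|` because the first policy is
uniform. The errors add up to at most the same amount, hence the factor 2.

The inner loop is analysed exactly: with step size `(1 - γ) / α`, a natural gradient step replaces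
the policy by the anchor tilted by `exp (Q / α)`, where `Q` is the current regularized action value
(`softmax_npgStep`). This is soft policy iteration. Monotonicity and `γ`-contraction of the soft
Bellman operator give geometric convergence, and the Gibbs identity `sum_mul_sub_log` supplies the
KL term of the three-point inequality.

Since `ρ` is arbitrary, the Fisher matrix carries no information about states that are never
visited. The policy iteration estimates are therefore confined to the reachable states, which form a
closed set carrying every visitation distribution. -/

namespace MOMDP

variable {S A : Type*} [Fintype S] [Fintype A] {m : ℕ}

/-! ### Visitation distributions and the performance difference identity -/

theorem one_sub_γ_pos (M : MOMDP S A m) : 0 < 1 - M.γ := sub_pos.2 M.γ_lt_one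

/-- The expected value of `W` at the next state. -/
def next (M : MOMDP S A m) (W : S → ℝ) (s : S) (a : A) : ℝ :=
  ∑ s', M.P s a s' * W s'

theorem next_const (M : MOMDP S A m) (c : ℝ) (s : S) (a : A) :
    M.next (fun _ => c) s a = c := by
  simp [next, ← Finset.sum_mul, (M.P_mem s a).2]

theorem next_sub (M : MOMDP S A m) (V W : S → ℝ) (s : S) (a : A) :
    M.next (fun x => V x - W x) s a = M.next V s a - M.next W s a := by
  simp [next, mul_sub, Finset.sum_sub_distrib]

theorem stateProb_mem (M : MOMDP S A m) {π : S → A → ℝ} (hπ : IsPolicy π) (t : ℕ) :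
    M.stateProb π t ∈ stdSimplex ℝ S := by
  induction t with
  | zero => exact M.ρ_mem
  | succ t ih =>
    refine ⟨fun s' => Finset.sum_nonneg fun s _ => Finset.sum_nonneg fun a _ =>
      mul_nonneg (mul_nonneg (ih.1 s) ((hπ s).1 a)) ((M.P_mem s a).1 s'), ?_⟩
    simp only [stateProb]
    rw [Finset.sum_comm]
    calc ∑ s, ∑ s', ∑ a, M.stateProb π t s * π s a * M.P s a s'
        = ∑ s, M.stateProb π t s := by
          refine Finset.sum_congr rfl fun s _ => ?_
          rw [Finset.sum_comm]
          simp only [← Finset.mul_sum, (M.P_mem s _).2, mul_one, (hπ s).2]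
      _ = 1 := ih.2

theorem stateProb_le_one (M : MOMDP S A m) {π : S → A → ℝ} (hπ : IsPolicy π) (t : ℕ) (s : S) :
    M.stateProb π t s ≤ 1 := by
  rw [← (M.stateProb_mem hπ t).2]
  exact Finset.single_le_sum (fun s _ => (M.stateProb_mem hπ t).1 s) (Finset.mem_univ s)

theorem norm_discounted_stateProb_le (M : MOMDP S A m) {π : S → A → ℝ} (hπ : IsPolicy π)
    (t : ℕ) (s : S) : ‖M.γ ^ t * M.stateProb π t s‖ ≤ M.γ ^ t := by
  have h0 := pow_nonneg M.γ_pos.le t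
  rw [Real.norm_of_nonneg (mul_nonneg h0 ((M.stateProb_mem hπ t).1 s))]
  exact mul_le_of_le_one_right h0 (M.stateProb_le_one hπ t s)

theorem summable_discount (M : MOMDP S A m) : Summable fun t : ℕ => M.γ ^ t :=
  summable_geometric_of_lt_one M.γ_pos.le M.γ_lt_one

theorem summable_stateProb (M : MOMDP S A m) {π : S → A → ℝ} (hπ : IsPolicy π) (s : S) :
    Summable fun t : ℕ => M.γ ^ t * M.stateProb π t s :=
  Summable.of_norm_bounded M.summable_discount fun t => M.norm_discounted_stateProb_le hπ t s

theorem saVisit_eq_tsum_mul (M : MOMDP S A m) (π : S → A → ℝ) (s : S) (a : A) :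
    M.saVisit π s a = (1 - M.γ) * (∑' t : ℕ, M.γ ^ t * M.stateProb π t s) * π s a := by
  simp only [saVisit, ← mul_assoc, tsum_mul_right]

theorem stateVisit_eq_tsum (M : MOMDP S A m) {π : S → A → ℝ} (hπ : IsPolicy π) (s : S) :
    M.stateVisit π s = (1 - M.γ) * ∑' t : ℕ, M.γ ^ t * M.stateProb π t s := by
  simp only [stateVisit, saVisit_eq_tsum_mul, ← Finset.mul_sum, (hπ s).2, mul_one]

theorem saVisit_eq (M : MOMDP S A m) {π : S → A → ℝ} (hπ : IsPolicy π) (s : S) (a : A) :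
    M.saVisit π s a = M.stateVisit π s * π s a := by
  rw [saVisit_eq_tsum_mul, stateVisit_eq_tsum M hπ]

theorem stateVisit_nonneg (M : MOMDP S A m) {π : S → A → ℝ} (hπ : IsPolicy π) (s : S) :
    0 ≤ M.stateVisit π s := by
  rw [stateVisit_eq_tsum M hπ]
  exact mul_nonneg M.one_sub_γ_pos.le
    (tsum_nonneg fun t => mul_nonneg (pow_nonneg M.γ_pos.le t) ((M.stateProb_mem hπ t).1 s))

theorem value_eq (M : MOMDP S A m) {π : S → A → ℝ} (hπ : IsPolicy π) (r : S → A → ℝ) :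
    M.value r π = (1 - M.γ)⁻¹ * ∑ s, M.stateVisit π s * ∑ a, π s a * r s a := by
  have h : HasSum (fun t : ℕ => ∑ s, M.γ ^ t * M.stateProb π t s * ∑ a, π s a * r s a)
      (∑ s, (∑' t : ℕ, M.γ ^ t * M.stateProb π t s) * ∑ a, π s a * r s a) :=
    hasSum_sum fun s _ => (M.summable_stateProb hπ s).hasSum.mul_right _
  have h' : M.value r π = ∑ s, (∑' t : ℕ, M.γ ^ t * M.stateProb π t s) * ∑ a, π s a * r s a := by
    rw [← h.tsum_eq, value]
    refine tsum_congr fun t => ?_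
    simp only [Finset.mul_sum, mul_assoc]
  rw [h', Finset.mul_sum]
  refine Finset.sum_congr rfl fun s _ => ?_
  rw [stateVisit_eq_tsum M hπ, ← mul_assoc, inv_mul_cancel_left₀ M.one_sub_γ_pos.ne']

theorem stateVisit_flow (M : MOMDP S A m) {π : S → A → ℝ} (hπ : IsPolicy π) (s' : S) :
    M.stateVisit π s' = (1 - M.γ) * M.ρ s' +
      M.γ * ∑ s, ∑ a, M.stateVisit π s * π s a * M.P s a s' := by
  have h : HasSum (fun t : ℕ => ∑ s, ∑ a, M.γ ^ t * M.stateProb π t s * (π s a * M.P s a s'))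
      (∑ s, ∑ a, (∑' t : ℕ, M.γ ^ t * M.stateProb π t s) * (π s a * M.P s a s')) :=
    hasSum_sum fun s _ => hasSum_sum fun a _ => (M.summable_stateProb hπ s).hasSum.mul_right _
  have h1 : ∑' t : ℕ, M.γ ^ (t + 1) * M.stateProb π (t + 1) s' =
      M.γ * ∑ s, ∑ a, (∑' t : ℕ, M.γ ^ t * M.stateProb π t s) * (π s a * M.P s a s') := by
    rw [← h.tsum_eq, ← tsum_mul_left]
    refine tsum_congr fun t => ?_
    simp only [stateProb, Finset.mul_sum, pow_succ]
    exact Finset.sum_congr rfl fun s _ => Finset.sum_congr rfl fun a _ => by ring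
  rw [stateVisit_eq_tsum M hπ s', (M.summable_stateProb hπ s').tsum_eq_zero_add, h1]
  simp only [stateVisit_eq_tsum M hπ, stateProb, pow_zero, one_mul, mul_add, Finset.mul_sum]
  congr 1
  exact Finset.sum_congr rfl fun s _ => Finset.sum_congr rfl fun a _ => by ring

/-- The flow equation tested against `W`; all performance difference computations rest on this form.
-/
theorem sum_stateVisit_mul (M : MOMDP S A m) {π : S → A → ℝ} (hπ : IsPolicy π) (W : S → ℝ) :
    ∑ s, M.stateVisit π s * W s = (1 - M.γ) * ∑ s, M.ρ s * W s +
      ∑ s, M.stateVisit π s * ∑ a, π s a * (M.γ * M.next W s a) := by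
  calc ∑ s', M.stateVisit π s' * W s'
      = ∑ s', ((1 - M.γ) * (M.ρ s' * W s') +
          ∑ s, ∑ a, M.γ * (M.stateVisit π s * π s a * M.P s a s' * W s')) := by
        refine Finset.sum_congr rfl fun s' _ => ?_
        rw [stateVisit_flow M hπ s', add_mul]
        simp only [Finset.mul_sum, Finset.sum_mul, mul_assoc]
    _ = _ := by
        rw [Finset.sum_add_distrib, ← Finset.mul_sum, Finset.sum_comm]
        congr 1
        refine Finset.sum_congr rfl fun s _ => ?_
        rw [Finset.sum_comm, Finset.mul_sum]
        refine Finset.sum_congr rfl fun a _ => ?_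
        simp only [next, Finset.mul_sum]
        exact Finset.sum_congr rfl fun s' _ => by ring

theorem sum_stateVisit (M : MOMDP S A m) {π : S → A → ℝ} (hπ : IsPolicy π) :
    ∑ s, M.stateVisit π s = 1 := by
  have h := M.sum_stateVisit_mul hπ (fun _ => 1)
  simp only [next_const, mul_one, M.ρ_mem.2, ← Finset.sum_mul, (hπ _).2, one_mul] at h
  have := M.one_sub_γ_pos
  have h2 : (1 - M.γ) * ∑ s, M.stateVisit π s = (1 - M.γ) * 1 := by linarith
  exact mul_left_cancel₀ this.ne' h2

theorem regValue_eq (M : MOMDP S A m) {π : S → A → ℝ} (hπ : IsPolicy π) (r π₀ : S → A → ℝ)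
    (α : ℝ) :
    M.regValue r π₀ α π = (1 - M.γ)⁻¹ * ∑ s, M.stateVisit π s *
      ∑ a, π s a * (r s a - α * Real.log (π s a / π₀ s a)) := by
  rw [regValue, value_eq M hπ, policyKL, div_eq_inv_mul, mul_left_comm, ← mul_sub, Finset.mul_sum,
    ← Finset.sum_sub_distrib]
  congr 1
  refine Finset.sum_congr rfl fun s _ => ?_
  rw [mul_left_comm, ← mul_sub, klVec, Finset.mul_sum, ← Finset.sum_sub_distrib]
  congr 1
  exact Finset.sum_congr rfl fun a _ => by ring

/-- The performance difference identity with an arbitrary reference function `U`. -/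
theorem regValue_eq_add (M : MOMDP S A m) {π : S → A → ℝ} (hπ : IsPolicy π) (r π₀ : S → A → ℝ)
    (α : ℝ) (U : S → ℝ) :
    M.regValue r π₀ α π = ∑ s, M.ρ s * U s + (1 - M.γ)⁻¹ * ∑ s, M.stateVisit π s *
      (∑ a, π s a * (r s a + M.γ * M.next U s a - α * Real.log (π s a / π₀ s a)) - U s) := by
  have h := M.sum_stateVisit_mul hπ U
  have h1 : ∑ s, M.stateVisit π s *
      (∑ a, π s a * (r s a + M.γ * M.next U s a - α * Real.log (π s a / π₀ s a)) - U s) =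
      ∑ s, M.stateVisit π s * ∑ a, π s a * (r s a - α * Real.log (π s a / π₀ s a)) +
      ∑ s, M.stateVisit π s * ∑ a, π s a * (M.γ * M.next U s a) - ∑ s, M.stateVisit π s * U s := by
    rw [← Finset.sum_add_distrib, ← Finset.sum_sub_distrib]
    refine Finset.sum_congr rfl fun s _ => ?_
    rw [← mul_add, ← mul_sub, ← Finset.sum_add_distrib]
    congr 2
    exact Finset.sum_congr rfl fun a _ => by ring
  rw [regValue_eq M hπ, h1, h]
  have := M.one_sub_γ_pos.ne'
  field_simp
  ring

theorem regValue_zero (M : MOMDP S A m) (r π₀ π : S → A → ℝ) :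
    M.regValue r π₀ 0 π = M.value r π := by
  simp [regValue]

/-! ### Continuity in the policy -/

theorem continuous_stateProb (M : MOMDP S A m) (t : ℕ) (s : S) :
    Continuous fun π : S → A → ℝ => M.stateProb π t s := by
  induction t generalizing s with
  | zero => exact continuous_const
  | succ t ih =>
    simp only [stateProb]
    fun_prop

/-- The discounted series converges uniformly on policies. Continuity is enough both for the policy
gradient and for the existence of an optimum; visitation distributions are never differentiated. -/
theorem continuousOn_stateVisit (M : MOMDP S A m) (s : S) :
    ContinuousOn (fun π : S → A → ℝ => M.stateVisit π s) {π | IsPolicy π} := by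
  have h : ContinuousOn (fun π : S → A → ℝ => (1 - M.γ) * ∑' t : ℕ, M.γ ^ t * M.stateProb π t s)
      {π | IsPolicy π} := by
    refine continuousOn_const.mul (continuousOn_tsum (u := fun t : ℕ => M.γ ^ t) (fun t => ?_)
      M.summable_discount fun t π hπ => M.norm_discounted_stateProb_le hπ t s)
    exact (continuous_const.mul (M.continuous_stateProb t s)).continuousOn
  exact h.congr fun π hπ => M.stateVisit_eq_tsum hπ s

theorem continuousOn_value (M : MOMDP S A m) (r : S → A → ℝ) :
    ContinuousOn (fun π : S → A → ℝ => M.value r π) {π | IsPolicy π} := by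
  have h : ContinuousOn (fun π : S → A → ℝ =>
      (1 - M.γ)⁻¹ * ∑ s, M.stateVisit π s * ∑ a, π s a * r s a) {π | IsPolicy π} := by
    refine continuousOn_const.mul (continuousOn_finsetSum _ fun s _ =>
      (M.continuousOn_stateVisit s).mul ?_)
    exact Continuous.continuousOn (by fun_prop)
  exact h.congr fun π hπ => M.value_eq hπ r

/-! ### Reachable states and closed sets -/

/-- The states that can be reached from the support of the initial distribution. -/
inductive Reachable (M : MOMDP S A m) : S → Prop
  | init {s : S} : 0 < M.ρ s → Reachable M s
  | step {s : S} {a : A} {s' : S} : Reachable M s → 0 < M.P s a s' → Reachable M s'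

theorem stateVisit_eq_zero (M : MOMDP S A m) {π : S → A → ℝ} (hπ : IsPolicy π) {s : S}
    (hs : ¬ M.Reachable s) : M.stateVisit π s = 0 := by
  have h : ∀ (t : ℕ) (s : S), ¬ M.Reachable s → M.stateProb π t s = 0 := by
    intro t
    induction t with
    | zero =>
      intro s hs
      exact ((M.ρ_mem.1 s).antisymm (not_lt.1 fun h => hs (.init h))).symm
    | succ t ih =>
      intro s hs
      refine Finset.sum_eq_zero fun x _ => Finset.sum_eq_zero fun a _ => ?_
      by_cases hx : M.Reachable x
      · rw [← ((M.P_mem x a).1 s).antisymm (not_lt.1 fun h => hs (.step hx h)), mul_zero]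
      · rw [ih x hx, zero_mul, zero_mul]
  rw [stateVisit_eq_tsum M hπ]
  simp [h _ s hs]

/-- Induction along a path from the support of `ρ`: the flow equation passes positivity to every
successor, since a positive policy takes each action. -/
theorem stateVisit_pos (M : MOMDP S A m) {π : S → A → ℝ} (hπ : IsPolicy π)
    (hpos : ∀ s a, 0 < π s a) {s : S} (hs : M.Reachable s) : 0 < M.stateVisit π s := by
  induction hs with
  | @init s h =>
    rw [stateVisit_flow M hπ]
    refine add_pos_of_pos_of_nonneg (mul_pos M.one_sub_γ_pos h) (mul_nonneg M.γ_pos.le ?_)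
    exact Finset.sum_nonneg fun x _ => Finset.sum_nonneg fun a _ =>
      mul_nonneg (mul_nonneg (M.stateVisit_nonneg hπ x) ((hπ x).1 a)) ((M.P_mem x a).1 s)
  | @step s a s' hs hP ih =>
    rw [stateVisit_flow M hπ]
    refine add_pos_of_nonneg_of_pos (mul_nonneg M.one_sub_γ_pos.le (M.ρ_mem.1 s'))
      (mul_pos M.γ_pos ?_)
    have hnn : ∀ x b, 0 ≤ M.stateVisit π x * π x b * M.P x b s' := fun x b =>
      mul_nonneg (mul_nonneg (M.stateVisit_nonneg hπ x) ((hπ x).1 b)) ((M.P_mem x b).1 s')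
    calc 0 < M.stateVisit π s * π s a * M.P s a s' := mul_pos (mul_pos ih (hpos s a)) hP
      _ ≤ ∑ b, M.stateVisit π s * π s b * M.P s b s' :=
          Finset.single_le_sum (f := fun b => M.stateVisit π s * π s b * M.P s b s')
            (fun b _ => hnn s b) (Finset.mem_univ a)
      _ ≤ _ := Finset.single_le_sum
            (f := fun x => ∑ b, M.stateVisit π x * π x b * M.P x b s')
            (fun x _ => Finset.sum_nonneg fun b _ => hnn x b) (Finset.mem_univ s)

/-- A set of states that the process never leaves. -/
def IsClosedSet (M : MOMDP S A m) (p : S → Prop) : Prop :=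
  ∀ s a s', p s → 0 < M.P s a s' → p s'

theorem isClosedSet_reachable (M : MOMDP S A m) : M.IsClosedSet M.Reachable :=
  fun _ _ _ hs hP => hs.step hP

theorem isClosedSet_true (M : MOMDP S A m) : M.IsClosedSet fun _ => True :=
  fun _ _ _ _ _ => trivial

theorem next_mono (M : MOMDP S A m) {p : S → Prop} (hp : M.IsClosedSet p) {V W : S → ℝ}
    (h : ∀ s, p s → V s ≤ W s) {s : S} (hs : p s) (a : A) : M.next V s a ≤ M.next W s a := by
  refine Finset.sum_le_sum fun s' _ => ?_
  rcases ((M.P_mem s a).1 s').eq_or_lt with h0 | h0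
  · simp [← h0]
  · exact mul_le_mul_of_nonneg_left (h s' (hp s a s' hs h0)) h0.le

/-! ### Minimum principle, Bellman equations and value bounds -/

/-- The minimum principle on a closed set of states. -/
theorem nonneg_of_next_le (M : MOMDP S A m) {p : S → Prop} (hp : M.IsClosedSet p)
    {π : S → A → ℝ} (hπ : IsPolicy π) {W : S → ℝ}
    (h : ∀ s, p s → ∑ a, π s a * (M.γ * M.next W s a) ≤ W s) (s : S) (hs : p s) : 0 ≤ W s := by
  classical
  obtain ⟨s₀, hs₀, hmin⟩ := Finset.exists_min_image (Finset.univ.filter p) W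
    ⟨s, by simpa using hs⟩
  simp only [Finset.mem_filter, Finset.mem_univ, true_and] at hs₀ hmin
  refine le_trans ?_ (hmin s hs)
  -- At a minimizer within the closed set, all successors have values at least `W s₀`; as `γ < 1`,
  -- the resulting inequality excludes a negative minimum.
  have h1 : M.γ * W s₀ ≤ W s₀ := by
    refine le_trans ?_ (h s₀ hs₀)
    calc M.γ * W s₀ = ∑ a, π s₀ a * (M.γ * W s₀) := by rw [← Finset.sum_mul, (hπ s₀).2, one_mul]
      _ ≤ _ := Finset.sum_le_sum fun a _ => mul_le_mul_of_nonneg_left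
          (mul_le_mul_of_nonneg_left (by
            simpa [next_const] using M.next_mono hp (V := fun _ => W s₀) hmin hs₀ a) M.γ_pos.le)
          ((hπ s₀).1 a)
  by_contra hneg
  nlinarith [M.γ_lt_one]

/-- The Bellman equation of a policy has a solution. -/
theorem exists_bellman (M : MOMDP S A m) {π : S → A → ℝ} (hπ : IsPolicy π) (c : S → A → ℝ) :
    ∃ V : S → ℝ, ∀ s, V s = ∑ a, π s a * (c s a + M.γ * M.next V s a) := by
  let T : (S → ℝ) →ₗ[ℝ] (S → ℝ) :=
    { toFun := fun V s => V s - ∑ a, π s a * (M.γ * M.next V s a)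
      map_add' := fun V W => by
        funext s
        simp only [next, Pi.add_apply, mul_add, Finset.sum_add_distrib]
        ring
      map_smul' := fun x V => by
        funext s
        simp only [next, Pi.smul_apply, smul_eq_mul, RingHom.id_apply, mul_sub, Finset.mul_sum]
        congr 1
        exact Finset.sum_congr rfl fun a _ => Finset.sum_congr rfl fun b _ => by ring }
  have hT : ∀ V s, T V s = V s - ∑ a, π s a * (M.γ * M.next V s a) := fun _ _ => rfl
  -- The minimum principle applied to `V` and `-V` kills the kernel; in finite dimension this gives
  -- surjectivity.
  have hinj : Function.Injective T := by
    rw [injective_iff_map_eq_zero]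
    intro V hV
    have hpos : ∀ W : S → ℝ, T W = 0 → ∀ s, 0 ≤ W s := fun W hW =>
      fun s => M.nonneg_of_next_le M.isClosedSet_true hπ (fun s _ => by
        have := congrFun hW s
        rw [hT, Pi.zero_apply] at this
        linarith) s trivial
    funext s
    have h2 := hpos (-V) (by rw [map_neg, hV, neg_zero]) s
    rw [Pi.neg_apply] at h2
    exact le_antisymm (neg_nonneg.1 h2) (hpos V hV s)
  obtain ⟨V, hV⟩ := LinearMap.injective_iff_surjective.1 hinj fun s => ∑ a, π s a * c s a
  refine ⟨V, fun s => ?_⟩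
  have := congrFun hV s
  rw [hT] at this
  simp only [mul_add, Finset.sum_add_distrib]
  linarith

theorem regValue_eq_of_bellman (M : MOMDP S A m) {π : S → A → ℝ} (hπ : IsPolicy π)
    {r π₀ : S → A → ℝ} {α : ℝ} {V : S → ℝ}
    (hV : ∀ s, V s = ∑ a, π s a *
      (r s a + M.γ * M.next V s a - α * Real.log (π s a / π₀ s a))) :
    M.regValue r π₀ α π = ∑ s, M.ρ s * V s := by
  rw [M.regValue_eq_add hπ r π₀ α V]
  simp [← hV]

/-- Lower bound for a solution of the Bellman equation. -/
theorem le_of_bellman (M : MOMDP S A m) {π : S → A → ℝ} (hπ : IsPolicy π) {c : S → A → ℝ}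
    {V : S → ℝ} (hV : ∀ s, V s = ∑ a, π s a * (c s a + M.γ * M.next V s a)) {l : ℝ}
    (hl : ∀ s a, l ≤ c s a) (s : S) : l / (1 - M.γ) ≤ V s := by
  have h := M.nonneg_of_next_le M.isClosedSet_true hπ (W := fun s => V s - l / (1 - M.γ))
    (fun s _ => ?_) s trivial
  · linarith
  · have h1 : l / (1 - M.γ) = l + M.γ * (l / (1 - M.γ)) := by
      have := M.one_sub_γ_pos.ne'
      field_simp
      ring
    have h2 : ∑ a, π s a * l ≤ ∑ a, π s a * c s a :=
      Finset.sum_le_sum fun a _ => mul_le_mul_of_nonneg_left (hl s a) ((hπ s).1 a)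
    rw [← Finset.sum_mul, (hπ s).2, one_mul] at h2
    simp only [next_sub, next_const, mul_sub, Finset.sum_sub_distrib]
    rw [hV s, ← Finset.sum_mul, (hπ s).2, one_mul]
    simp only [mul_add, Finset.sum_add_distrib]
    linarith

theorem bellman_le (M : MOMDP S A m) {π : S → A → ℝ} (hπ : IsPolicy π) {c : S → A → ℝ}
    {V : S → ℝ} (hV : ∀ s, V s = ∑ a, π s a * (c s a + M.γ * M.next V s a)) {u : ℝ}
    (hu : ∀ s a, c s a ≤ u) (s : S) : V s ≤ u / (1 - M.γ) := by
  have h := M.le_of_bellman hπ (c := fun s a => -c s a) (V := fun s => -V s) (l := -u)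
    (fun s => ?_) (fun s a => neg_le_neg (hu s a)) s
  · rw [neg_div] at h
    linarith
  · rw [hV s, ← Finset.sum_neg_distrib]
    refine Finset.sum_congr rfl fun a _ => ?_
    simp only [next, mul_neg, Finset.sum_neg_distrib]
    ring

theorem value_mem_Icc (M : MOMDP S A m) {π : S → A → ℝ} (hπ : IsPolicy π) {r : S → A → ℝ}
    {l u : ℝ} (hr : ∀ s a, r s a ∈ Set.Icc l u) :
    M.value r π ∈ Set.Icc (l / (1 - M.γ)) (u / (1 - M.γ)) := by
  obtain ⟨V, hV⟩ := M.exists_bellman hπ r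
  have h : M.value r π = ∑ s, M.ρ s * V s := by
    rw [← M.regValue_zero r π π, M.regValue_eq_of_bellman hπ (by simpa using hV)]
  have h1 : ∀ x : ℝ, x = ∑ s, M.ρ s * x := fun x => by rw [← Finset.sum_mul, M.ρ_mem.2, one_mul]
  rw [h]
  constructor
  · rw [h1 (l / (1 - M.γ))]
    exact Finset.sum_le_sum fun s _ => mul_le_mul_of_nonneg_left
      (M.le_of_bellman hπ hV (fun s a => (hr s a).1) s) (M.ρ_mem.1 s)
  · rw [h1 (u / (1 - M.γ))]
    exact Finset.sum_le_sum fun s _ => mul_le_mul_of_nonneg_left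
      (M.bellman_le hπ hV (fun s a => (hr s a).2) s) (M.ρ_mem.1 s)

theorem valueVec_mem (M : MOMDP S A m) {π : S → A → ℝ} (hπ : IsPolicy π) :
    M.valueVec π ∈ valueBox m M.γ := by
  have h := fun i => M.value_mem_Icc hπ (M.r_mem i)
  exact ⟨fun i => (zero_div (1 - M.γ)).ge.trans (h i).1, fun i => (h i).2⟩

end MOMDP

/-- Where `g` vanishes, the product rule needs only continuity of `c`, because the term containing
the derivative of `c` is multiplied by zero. -/
theorem HasFDerivAt.mul_of_eq_zero {E : Type*} [NormedAddCommGroup E] [NormedSpace ℝ E]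
    {c g : E → ℝ} {g' : E →L[ℝ] ℝ} {x : E} (hc : ContinuousAt c x) (hg : HasFDerivAt g g' x)
    (hx : g x = 0) : HasFDerivAt (fun y => c y * g y) (c x • g') x := by
  have h1 : (fun y => c y * (g y - g x - g' (y - x))) =o[nhds x] fun y => y - x := by
    have := (hc.isBigO_one ℝ).mul_isLittleO hg.isLittleO.norm_right
    exact (this.congr_right fun y => one_mul _).of_norm_right
  have h2 : (fun y => (c y - c x) * g' (y - x)) =o[nhds x] fun y => y - x := by
    have h3 : (fun y => c y - c x) =o[nhds x] fun _ => (1 : ℝ) := by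
      rw [Asymptotics.isLittleO_one_iff]
      exact tendsto_sub_nhds_zero_iff.2 hc
    have := h3.mul_isBigO (g'.isBigO_sub (nhds x) x).norm_right
    exact (this.congr_right fun y => one_mul _).of_norm_right
  refine HasFDerivAt.of_isLittleO ((h1.add h2).congr_left fun y => ?_)
  simp only [hx, smul_apply, smul_eq_mul]
  ring

/-! ### Differential calculus of softmax policies -/

section Softmax

variable {S A : Type*} [Fintype A]

/-- The shift `c` is independent of the action and cancels in the normalization. It absorbs
everything that a natural gradient step leaves undetermined. -/
theorem softmax_eq_of_eq_add {θ : S × A → ℝ} {s : S} {p x : A → ℝ} (hp : ∀ a, 0 < p a) (c : ℝ)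
    (h : ∀ a, θ (s, a) = Real.log (p a) + x a + c) (a : A) :
    softmax θ s a = p a * Real.exp (x a) / ∑ b, p b * Real.exp (x b) := by
  have h1 : ∀ a, Real.exp (θ (s, a)) = p a * Real.exp (x a) * Real.exp c := fun a => by
    rw [h, Real.exp_add, Real.exp_add, Real.exp_log (hp a)]
  simp only [softmax, h1]
  rw [← Finset.sum_mul, mul_div_mul_right _ _ (Real.exp_pos c).ne']

/-- The score function `∇_θ log π_θ(a|s)` as a linear functional. -/
noncomputable def score (θ : S × A → ℝ) (s : S) (a : A) : (S × A → ℝ) →L[ℝ] ℝ :=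
  ContinuousLinearMap.proj (s, a) - ∑ b, softmax θ s b • ContinuousLinearMap.proj (s, b)

theorem score_apply (θ : S × A → ℝ) (s : S) (a : A) (x : S × A → ℝ) :
    score θ s a x = x (s, a) - ∑ b, softmax θ s b * x (s, b) := by
  simp [score]

variable [Nonempty A]

theorem sum_exp_pos (f : A → ℝ) : 0 < ∑ a, Real.exp (f a) :=
  Finset.sum_pos (fun _ _ => Real.exp_pos _) Finset.univ_nonempty

theorem softmax_pos (θ : S × A → ℝ) (s : S) (a : A) : 0 < softmax θ s a :=
  div_pos (Real.exp_pos _) (sum_exp_pos fun b => θ (s, b))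

theorem isPolicy_softmax (θ : S × A → ℝ) : IsPolicy (softmax θ) := fun s =>
  ⟨fun a => (softmax_pos θ s a).le, by
    simp only [softmax, ← Finset.sum_div]
    exact div_self (sum_exp_pos fun b => θ (s, b)).ne'⟩

theorem sum_softmax (θ : S × A → ℝ) (s : S) : ∑ a, softmax θ s a = 1 :=
  (isPolicy_softmax θ s).2

theorem log_softmax (θ : S × A → ℝ) (s : S) (a : A) :
    Real.log (softmax θ s a) = θ (s, a) - Real.log (∑ b, Real.exp (θ (s, b))) := by
  rw [softmax, Real.log_div (Real.exp_pos _).ne' (sum_exp_pos fun b => θ (s, b)).ne', Real.log_exp]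

theorem sum_softmax_smul_score (θ : S × A → ℝ) (s : S) :
    ∑ a, softmax θ s a • score θ s a = 0 := by
  ext x
  simp only [sum_apply, smul_apply, score_apply,
    smul_eq_mul, mul_sub, Finset.sum_sub_distrib, ← Finset.sum_mul, sum_softmax, one_mul, sub_self,
    zero_apply]

variable [Fintype S]

theorem hasFDerivAt_log_softmax (θ : S × A → ℝ) (s : S) (a : A) :
    HasFDerivAt (fun θ' => Real.log (softmax θ' s a)) (score θ s a) θ := by
  simp only [log_softmax]
  have h0 : ∀ b, HasFDerivAt (fun θ' : S × A → ℝ => θ' (s, b))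
      (ContinuousLinearMap.proj (s, b) : (S × A → ℝ) →L[ℝ] ℝ) θ := fun b => hasFDerivAt_apply _ _
  have h1 : HasFDerivAt (fun θ' : S × A → ℝ => ∑ b, Real.exp (θ' (s, b)))
      (∑ b, Real.exp (θ (s, b)) • (ContinuousLinearMap.proj (s, b) : (S × A → ℝ) →L[ℝ] ℝ)) θ :=
    HasFDerivAt.fun_sum fun b _ => (h0 b).exp
  refine ((h0 a).sub (h1.log (sum_exp_pos fun b => θ (s, b)).ne')).congr_fderiv ?_
  rw [score, Finset.smul_sum]
  congr 1
  refine Finset.sum_congr rfl fun b _ => ?_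
  rw [smul_smul, softmax, div_eq_inv_mul]

theorem hasFDerivAt_softmax (θ : S × A → ℝ) (s : S) (a : A) :
    HasFDerivAt (fun θ' => softmax θ' s a) (softmax θ s a • score θ s a) θ := by
  have h := (hasFDerivAt_log_softmax θ s a).exp
  simpa only [Real.exp_log (softmax_pos _ s a)] using h

theorem continuous_softmax : Continuous fun θ : S × A → ℝ => softmax θ :=
  continuous_pi fun s => continuous_pi fun a => continuous_iff_continuousAt.2 fun θ =>
    (hasFDerivAt_softmax θ s a).continuousAt

theorem hasFDerivAt_entropic (θ : S × A → ℝ) (s : S) (q p : A → ℝ) (hp : ∀ a, 0 < p a) (α : ℝ) :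
    HasFDerivAt (fun θ' => ∑ a, softmax θ' s a * (q a - α * Real.log (softmax θ' s a / p a)))
      (∑ a, (softmax θ s a * (q a - α * Real.log (softmax θ s a / p a))) • score θ s a) θ := by
  have h : ∀ a, HasFDerivAt
      (fun θ' => softmax θ' s a * (q a - α * Real.log (softmax θ' s a / p a)))
      (softmax θ s a • (-(α • score θ s a)) +
        (q a - α * Real.log (softmax θ s a / p a)) • (softmax θ s a • score θ s a)) θ := by
    intro a
    simp only [Real.log_div (softmax_pos _ s a).ne' (hp a).ne']
    exact (hasFDerivAt_softmax θ s a).mul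
      ((((hasFDerivAt_log_softmax θ s a).sub_const (Real.log (p a))).const_mul α).const_sub (q a))
  refine (HasFDerivAt.fun_sum fun a _ => h a).congr_fderiv ?_
  -- Differentiating the logarithm contributes nothing, since the score has mean zero.
  have h2 : ∑ a, softmax θ s a • (-(α • score θ s a)) = 0 := by
    simp only [smul_neg, Finset.sum_neg_distrib, smul_comm _ α, ← Finset.smul_sum,
      sum_softmax_smul_score, smul_zero, neg_zero]
  rw [Finset.sum_add_distrib, h2, zero_add]
  refine Finset.sum_congr rfl fun a _ => ?_
  rw [smul_smul, mul_comm]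

end Softmax

theorem partials_eq_of_hasFDerivAt {ι : Type*} [Fintype ι] [DecidableEq ι] {f : (ι → ℝ) → ℝ}
    {f' : (ι → ℝ) →L[ℝ] ℝ} {θ : ι → ℝ} (h : HasFDerivAt f f' θ) :
    partials f θ = fun i => f' (Pi.single i 1) := by
  funext i
  rw [partials, h.fderiv]

theorem sum_apply_single_mul {ι : Type*} [Fintype ι] [DecidableEq ι] (f : (ι → ℝ) →L[ℝ] ℝ)
    (x : ι → ℝ) : ∑ i, f (Pi.single i 1) * x i = f x := by
  have h : x = ∑ i, x i • Pi.single i (1 : ℝ) := by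
    ext j
    simp [Finset.sum_apply, Pi.single_apply]
  conv_rhs => rw [h, map_sum]
  simp only [map_smul, smul_eq_mul, mul_comm]

/-! ### Policy gradient, Fisher matrix and the natural gradient step -/

namespace MOMDP

variable {S A : Type*} [Fintype S] [Fintype A] {m : ℕ} [Nonempty A]

/-- The policy gradient theorem. The reference function in `regValue_eq_add` is frozen at the
regularized value of `softmax θ`; each bracket then vanishes at `θ`, and
`HasFDerivAt.mul_of_eq_zero` removes the derivative of the visitation weights. -/
theorem hasFDerivAt_regValue (M : MOMDP S A m) {r π₀ : S → A → ℝ} (hπ₀ : ∀ s a, 0 < π₀ s a)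
    {α : ℝ} {θ : S × A → ℝ} {V : S → ℝ}
    (hV : ∀ s, V s = ∑ a, softmax θ s a *
      (r s a + M.γ * M.next V s a - α * Real.log (softmax θ s a / π₀ s a))) :
    HasFDerivAt (fun θ' => M.regValue r π₀ α (softmax θ'))
      ((1 - M.γ)⁻¹ • ∑ s, M.stateVisit (softmax θ) s • ∑ a, (softmax θ s a *
        (r s a + M.γ * M.next V s a - α * Real.log (softmax θ s a / π₀ s a))) • score θ s a) θ := by
  simp only [fun θ' : S × A → ℝ => M.regValue_eq_add (isPolicy_softmax θ') r π₀ α V]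
  refine HasFDerivAt.const_add _ (HasFDerivAt.const_mul (HasFDerivAt.fun_sum fun s _ => ?_) _)
  refine HasFDerivAt.mul_of_eq_zero (c := fun θ' => M.stateVisit (softmax θ') s) ?_
    ((hasFDerivAt_entropic θ s _ (π₀ s) (hπ₀ s) α).sub_const (V s)) (sub_eq_zero.2 (hV s).symm)
  exact ((M.continuousOn_stateVisit s).comp_continuous continuous_softmax
    isPolicy_softmax).continuousAt

variable [DecidableEq S] [DecidableEq A]

theorem fisher_mulVec (M : MOMDP S A m) (θ x : S × A → ℝ) :
    (M.fisher θ).mulVec x = fun i => ∑ s, M.stateVisit (softmax θ) s *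
      ∑ a, softmax θ s a * score θ s a x * score θ s a (Pi.single i 1) := by
  funext i
  simp only [fisher, Matrix.mulVec, dotProduct, Matrix.sum_apply, Matrix.smul_apply,
    Matrix.vecMulVec_apply, partials_eq_of_hasFDerivAt (hasFDerivAt_log_softmax θ _ _),
    smul_eq_mul, M.saVisit_eq (isPolicy_softmax θ), Finset.sum_mul]
  rw [Finset.sum_comm]
  refine Finset.sum_congr rfl fun s _ => ?_
  rw [Finset.sum_comm, Finset.mul_sum]
  refine Finset.sum_congr rfl fun a _ => ?_
  rw [← sum_apply_single_mul (score θ s a) x]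
  simp only [Finset.mul_sum, Finset.sum_mul]
  exact Finset.sum_congr rfl fun j _ => by ring

/-- The kernel of the Fisher matrix: vectors constant in the action at reachable states. -/
theorem score_eq_zero_of_fisher_mulVec (M : MOMDP S A m) {θ z : S × A → ℝ}
    (h : (M.fisher θ).mulVec z = 0) {s : S} (hs : M.Reachable s) (a : A) : score θ s a z = 0 := by
  have hd := fun s => M.stateVisit_nonneg (isPolicy_softmax θ) s
  -- This sum is the quadratic form of the Fisher matrix at `z`. Its terms are nonnegative with
  -- positive weights at reachable states.
  have h1 : ∑ s, M.stateVisit (softmax θ) s * ∑ a, softmax θ s a * (score θ s a z) ^ 2 = 0 := by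
    have h2 : z ⬝ᵥ (M.fisher θ).mulVec z = 0 := by rw [h, dotProduct_zero]
    rw [← h2, fisher_mulVec]
    simp only [dotProduct, Finset.mul_sum]
    symm
    rw [Finset.sum_comm]
    refine Finset.sum_congr rfl fun s _ => ?_
    rw [Finset.sum_comm]
    refine Finset.sum_congr rfl fun a _ => ?_
    rw [sq]
    nth_rewrite 3 [← sum_apply_single_mul (score θ s a) z]
    simp only [Finset.mul_sum]
    exact Finset.sum_congr rfl fun j _ => by ring
  have hn : ∀ s a, 0 ≤ softmax θ s a * (score θ s a z) ^ 2 := fun s a =>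
    mul_nonneg (softmax_pos θ s a).le (sq_nonneg _)
  rw [Finset.sum_eq_zero_iff_of_nonneg fun s _ =>
    mul_nonneg (hd s) (Finset.sum_nonneg fun a _ => hn s a)] at h1
  have h3 := (mul_eq_zero.1 (h1 s (Finset.mem_univ s))).resolve_left
    (M.stateVisit_pos (isPolicy_softmax θ) (softmax_pos θ) hs).ne'
  rw [Finset.sum_eq_zero_iff_of_nonneg fun a _ => hn s a] at h3
  exact pow_eq_zero_iff two_ne_zero |>.1
    ((mul_eq_zero.1 (h3 a (Finset.mem_univ a))).resolve_left (softmax_pos θ s a).ne')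

/-- A natural policy gradient step with the step size `(1-γ)/α` is a soft policy iteration step
at the reachable states. -/
theorem softmax_npgStep (M : MOMDP S A m) {r π₀ : S → A → ℝ} (hπ₀ : ∀ s a, 0 < π₀ s a)
    {α : ℝ} (hα : 0 < α) {θ : S × A → ℝ} {V : S → ℝ}
    (hV : ∀ s, V s = ∑ a, softmax θ s a *
      (r s a + M.γ * M.next V s a - α * Real.log (softmax θ s a / π₀ s a)))
    {s : S} (hs : M.Reachable s) (a : A) :
    softmax (M.npgStep r π₀ α ((1 - M.γ) / α) θ) s a =
      π₀ s a * Real.exp ((r s a + M.γ * M.next V s a) / α) /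
        ∑ b, π₀ s b * Real.exp ((r s b + M.γ * M.next V s b) / α) := by
  have hγ := M.one_sub_γ_pos
  -- An explicit preimage of the gradient under the Fisher matrix. Centering it by its mean changes
  -- nothing because the score has mean zero.
  let w : S × A → ℝ := fun i => (1 - M.γ)⁻¹ * (r i.1 i.2 + M.γ * M.next V i.1 i.2 -
    α * Real.log (softmax θ i.1 i.2 / π₀ i.1 i.2))
  have hgrad : partials (fun θ' => M.regValue r π₀ α (softmax θ')) θ =
      (M.fisher θ).mulVec w := by
    rw [partials_eq_of_hasFDerivAt (M.hasFDerivAt_regValue hπ₀ hV), fisher_mulVec]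
    funext i
    simp only [smul_apply, sum_apply, smul_eq_mul]
    rw [Finset.mul_sum]
    refine Finset.sum_congr rfl fun s _ => ?_
    rw [mul_left_comm]
    congr 1
    have h0 := congrArg (fun f => f (Pi.single i (1 : ℝ))) (sum_softmax_smul_score θ s)
    simp only [sum_apply, smul_apply, smul_eq_mul,
      zero_apply] at h0
    have h1 : ∑ a, softmax θ s a * score θ s a w * score θ s a (Pi.single i 1) =
        ∑ a, softmax θ s a * w (s, a) * score θ s a (Pi.single i 1) -
        (∑ b, softmax θ s b * w (s, b)) * ∑ a, softmax θ s a * score θ s a (Pi.single i 1) := by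
      rw [Finset.mul_sum, ← Finset.sum_sub_distrib]
      refine Finset.sum_congr rfl fun a _ => ?_
      rw [score_apply θ s a w]
      ring
    rw [h1, h0, mul_zero, sub_zero, Finset.mul_sum]
    refine Finset.sum_congr rfl fun a _ => ?_
    simp only [w]
    ring
  set u := (moorePenrose (M.fisher θ)).mulVec
    (partials (fun θ' => M.regValue r π₀ α (softmax θ')) θ) with hu
  -- The gradient lies in the range of the Fisher matrix, so the first Penrose equation suffices:
  -- `u` and `w` differ by a kernel vector, constant in the action at reachable states.
  have hker : (M.fisher θ).mulVec (u - w) = 0 := by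
    rw [Matrix.mulVec_sub, hu, hgrad, Matrix.mulVec_mulVec, Matrix.mulVec_mulVec,
      (moorePenrose_spec (M.fisher_isHermitian θ)).1, sub_self]
  have hz := fun a => M.score_eq_zero_of_fisher_mulVec hker hs a
  simp only [score_apply, Pi.sub_apply] at hz
  refine softmax_eq_of_eq_add (x := fun b => (r s b + M.γ * M.next V s b) / α) (hπ₀ s)
    (((1 - M.γ) / α) * (∑ b, softmax θ s b * (u (s, b) - w (s, b))) +
      Real.log (∑ b, Real.exp (θ (s, b)))) (fun b => ?_) a
  have h1 : u (s, b) = w (s, b) + ∑ b, softmax θ s b * (u (s, b) - w (s, b)) := by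
    linarith [hz b]
  have h2 : M.npgStep r π₀ α ((1 - M.γ) / α) θ (s, b) = θ (s, b) + (1 - M.γ) / α * u (s, b) := rfl
  have h3 : θ (s, b) = Real.log (softmax θ s b) + Real.log (∑ b, Real.exp (θ (s, b))) := by
    rw [log_softmax]; ring
  rw [h2, h3]
  nth_rewrite 1 [h1]
  -- For this step size, the term `log π_θ` in `w` cancels the one in `θ`. Only the anchor and the
  -- action value remain.
  simp only [w, Real.log_div (softmax_pos θ s b).ne' (hπ₀ s b).ne']
  field_simp
  ring

end MOMDP

/-! ### Relative entropy and the Gibbs variational principle -/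

section Entropy

variable {A : Type*} [Fintype A]

/-- The scaled log-sum-exp function with weights `p`. -/
noncomputable def softSup (α : ℝ) (p q : A → ℝ) : ℝ :=
  α * Real.log (∑ a, p a * Real.exp (q a / α))

/-- The exponential tilting of the probability vector `p`. -/
noncomputable def tilt (α : ℝ) (p q : A → ℝ) (a : A) : ℝ :=
  p a * Real.exp (q a / α) / ∑ b, p b * Real.exp (q b / α)

/-- Apply `log u ≤ u - 1` at `u = √y / √x`. After summation over probability vectors, the linear
terms cancel and the squared Hellinger distance remains. -/
theorem mul_log_div_ge {x y : ℝ} (hx : 0 ≤ x) (hy : 0 < y) :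
    (√x - √y) ^ 2 + x - y ≤ x * Real.log (x / y) := by
  rcases hx.eq_or_lt with rfl | hx
  · simp [hy.le]
  · have hsx := Real.sqrt_pos.2 hx
    have hsy := Real.sqrt_pos.2 hy
    have h1 := Real.log_le_sub_one_of_pos (div_pos hsy hsx)
    have h2 : Real.log (x / y) = -(2 * Real.log (√y / √x)) := by
      rw [Real.log_div hx.ne' hy.ne', Real.log_div hsy.ne' hsx.ne', Real.log_sqrt hx.le,
        Real.log_sqrt hy.le]
      ring
    have h3 : x * (√y / √x) = √x * √y := by
      nth_rewrite 1 [← Real.mul_self_sqrt hx.le]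
      field_simp
    have h4 := mul_le_mul_of_nonneg_left h1 hx.le
    rw [h2]
    nlinarith [Real.sq_sqrt hx.le, Real.sq_sqrt hy.le]

theorem sum_sq_sqrt_sub_sqrt_le_klVec {x y : A → ℝ} (hx : x ∈ stdSimplex ℝ A)
    (hy : y ∈ stdSimplex ℝ A) (hpos : ∀ a, 0 < y a) :
    ∑ a, (√(x a) - √(y a)) ^ 2 ≤ klVec x y := by
  have h := Finset.sum_le_sum fun a (_ : a ∈ Finset.univ) => mul_log_div_ge (hx.1 a) (hpos a)
  rw [Finset.sum_sub_distrib, Finset.sum_add_distrib, hx.2, hy.2] at h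
  simpa [klVec] using h

theorem klVec_nonneg {x y : A → ℝ} (hx : x ∈ stdSimplex ℝ A)
    (hy : y ∈ stdSimplex ℝ A) (hpos : ∀ a, 0 < y a) : 0 ≤ klVec x y :=
  (Finset.sum_nonneg fun _ _ => sq_nonneg _).trans (sum_sq_sqrt_sub_sqrt_le_klVec hx hy hpos)

/-- A Pinsker inequality, with a constant that is not optimal. -/
theorem sq_sum_abs_sub_le_klVec {x y : A → ℝ} (hx : x ∈ stdSimplex ℝ A)
    (hy : y ∈ stdSimplex ℝ A) (hpos : ∀ a, 0 < y a) :
    (∑ a, |x a - y a|) ^ 2 ≤ 4 * klVec x y := by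
  -- Factor the difference through square roots and use Cauchy-Schwarz; the second factor sums to at
  -- most 4.
  have h1 : ∀ a, |x a - y a| = |√(x a) - √(y a)| * (√(x a) + √(y a)) := fun a => by
    rw [← abs_of_nonneg (add_nonneg (Real.sqrt_nonneg (x a)) (Real.sqrt_nonneg (y a))), ← abs_mul]
    congr 1
    nlinarith [Real.sq_sqrt (hx.1 a), Real.sq_sqrt (hpos a).le]
  have h2 : ∑ a, (√(x a) + √(y a)) ^ 2 ≤ 4 := by
    calc ∑ a, (√(x a) + √(y a)) ^ 2 ≤ ∑ a, (2 * x a + 2 * y a) :=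
          Finset.sum_le_sum fun a _ => by
            nlinarith [Real.sq_sqrt (hx.1 a), Real.sq_sqrt (hpos a).le,
              sq_nonneg (√(x a) - √(y a))]
      _ = 4 := by
          rw [Finset.sum_add_distrib, ← Finset.mul_sum, ← Finset.mul_sum, hx.2, hy.2]
          norm_num
  have h3 := Finset.sum_mul_sq_le_sq_mul_sq Finset.univ (fun a => |√(x a) - √(y a)|)
    fun a => √(x a) + √(y a)
  simp only [h1]
  refine h3.trans ?_
  simp only [sq_abs]
  rw [mul_comm]
  exact mul_le_mul h2 (sum_sq_sqrt_sub_sqrt_le_klVec hx hy hpos)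
    (Finset.sum_nonneg fun _ _ => sq_nonneg _) (by norm_num)

theorem klVec_le_log_card {x y : A → ℝ} (hx : x ∈ stdSimplex ℝ A)
    (hy : ∀ a, y a = 1 / (Fintype.card A : ℝ)) :
    klVec x y ≤ Real.log (Fintype.card A) := by
  calc klVec x y ≤ ∑ a, x a * Real.log (Fintype.card A) := by
        refine Finset.sum_le_sum fun a _ => mul_le_mul_of_nonneg_left ?_ (hx.1 a)
        have : Nonempty A := ⟨a⟩
        have hc : (0 : ℝ) < Fintype.card A := by exact_mod_cast Fintype.card_pos
        have h1 : x a ≤ 1 := by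
          rw [← hx.2]
          exact Finset.single_le_sum (fun b _ => hx.1 b) (Finset.mem_univ a)
        rw [hy a, div_div_eq_mul_div, div_one]
        rcases (hx.1 a).eq_or_lt with h0 | h0
        · rw [← h0, zero_mul, Real.log_zero]
          exact Real.log_natCast_nonneg _
        · exact Real.log_le_log (mul_pos h0 hc) (mul_le_of_le_one_left hc.le h1)
    _ = Real.log (Fintype.card A) := by rw [← Finset.sum_mul, hx.2, one_mul]

section Tilt

variable [Nonempty A] {α : ℝ} {p : A → ℝ}

theorem sum_mul_exp_pos (hp : ∀ a, 0 < p a) (x : A → ℝ) : 0 < ∑ a, p a * Real.exp (x a) :=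
  Finset.sum_pos (fun a _ => mul_pos (hp a) (Real.exp_pos _)) Finset.univ_nonempty

theorem tilt_pos (hp : ∀ a, 0 < p a) (q : A → ℝ) (a : A) : 0 < tilt α p q a :=
  div_pos (mul_pos (hp a) (Real.exp_pos _)) (sum_mul_exp_pos hp fun a => q a / α)

theorem tilt_mem (hp : ∀ a, 0 < p a) (q : A → ℝ) : tilt α p q ∈ stdSimplex ℝ A :=
  ⟨fun a => (tilt_pos hp q a).le, by
    simp only [tilt, ← Finset.sum_div]
    exact div_self (sum_mul_exp_pos hp fun a => q a / α).ne'⟩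

/-- The penalized score is the same for all actions under the tilt. Hence the tilt attains the
supremum, and any other distribution loses exactly its KL divergence to it. -/
theorem sub_log_tilt (hα : 0 < α) (hp : ∀ a, 0 < p a) (q : A → ℝ) (a : A) :
    q a - α * Real.log (tilt α p q a / p a) = softSup α p q := by
  have hZ := sum_mul_exp_pos hp fun a => q a / α
  have h1 : tilt α p q a / p a = Real.exp (q a / α) / ∑ b, p b * Real.exp (q b / α) := by
    have := (hp a).ne'
    rw [tilt]
    field_simp
  rw [h1, Real.log_div (Real.exp_pos _).ne' hZ.ne', Real.log_exp, softSup]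
  have := hα.ne'
  field_simp
  ring

/-- The Gibbs variational identity. -/
theorem sum_mul_sub_log (hα : 0 < α) (hp : ∀ a, 0 < p a) (q : A → ℝ) {x : A → ℝ}
    (hx : x ∈ stdSimplex ℝ A) :
    ∑ a, x a * (q a - α * Real.log (x a / p a)) = softSup α p q - α * klVec x (tilt α p q) := by
  have h1 : softSup α p q = ∑ a, x a * softSup α p q := by rw [← Finset.sum_mul, hx.2, one_mul]
  rw [h1, klVec, Finset.mul_sum, ← Finset.sum_sub_distrib]
  refine Finset.sum_congr rfl fun a _ => ?_
  rcases (hx.1 a).eq_or_lt with h0 | h0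
  · simp [← h0]
  · rw [← sub_log_tilt hα hp q a, Real.log_div h0.ne' (hp a).ne',
      Real.log_div h0.ne' (tilt_pos hp q a).ne',
      Real.log_div (tilt_pos hp q a).ne' (hp a).ne']
    ring

theorem sum_mul_sub_log_le (hα : 0 < α) (hp : ∀ a, 0 < p a) (q : A → ℝ) {x : A → ℝ}
    (hx : x ∈ stdSimplex ℝ A) :
    ∑ a, x a * (q a - α * Real.log (x a / p a)) ≤ softSup α p q := by
  rw [sum_mul_sub_log hα hp q hx]
  have := mul_nonneg hα.le (klVec_nonneg hx (tilt_mem (α := α) hp q) (tilt_pos hp q))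
  linarith

/-- A shift by `c` multiplies the partition function by `exp (c / α)`. This yields both monotonicity
and the contraction of the soft Bellman operator. -/
theorem softSup_le_add (hα : 0 < α) (hp : ∀ a, 0 < p a) {q q' : A → ℝ} {c : ℝ}
    (h : ∀ a, q a ≤ q' a + c) : softSup α p q ≤ softSup α p q' + c := by
  have hZ := sum_mul_exp_pos hp fun a => q a / α
  have hZ' := sum_mul_exp_pos hp fun a => q' a / α
  have h1 : ∑ a, p a * Real.exp (q a / α) ≤
      (∑ a, p a * Real.exp (q' a / α)) * Real.exp (c / α) := by
    rw [Finset.sum_mul]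
    refine Finset.sum_le_sum fun a _ => ?_
    rw [mul_assoc, ← Real.exp_add, ← add_div]
    exact mul_le_mul_of_nonneg_left
      (Real.exp_le_exp.2 (div_le_div_of_nonneg_right (h a) hα.le)) (hp a).le
  have h2 := mul_le_mul_of_nonneg_left (Real.log_le_log hZ h1) hα.le
  rw [Real.log_mul hZ'.ne' (Real.exp_pos _).ne', Real.log_exp, mul_add,
    mul_div_cancel₀ _ hα.ne'] at h2
  exact h2

theorem softSup_le (hα : 0 < α) (hp : ∀ a, 0 < p a) (hp1 : ∑ a, p a = 1) {q : A → ℝ} {c : ℝ}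
    (h : ∀ a, q a ≤ c) : softSup α p q ≤ c := by
  have h1 := softSup_le_add hα hp (q' := fun _ => 0) (c := c) fun a => by simpa using h a
  simpa [softSup, hp1] using h1

end Tilt

end Entropy

/-! ### Soft Bellman operator and regularized policy iteration -/

namespace MOMDP

variable {S A : Type*} [Fintype S] [Fintype A] {m : ℕ}

/-- The Bellman equation of the regularized value of `π` with anchor `π₀`. -/
def IsRegBellman (M : MOMDP S A m) (r π₀ : S → A → ℝ) (α : ℝ) (π : S → A → ℝ) (V : S → ℝ) :
    Prop :=
  ∀ s, V s = ∑ a, π s a * (r s a + M.γ * M.next V s a - α * Real.log (π s a / π₀ s a))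

theorem exists_isRegBellman (M : MOMDP S A m) {π : S → A → ℝ} (hπ : IsPolicy π)
    (r π₀ : S → A → ℝ) (α : ℝ) : ∃ V, M.IsRegBellman r π₀ α π V := by
  obtain ⟨V, hV⟩ := M.exists_bellman hπ fun s a => r s a - α * Real.log (π s a / π₀ s a)
  refine ⟨V, fun s => (hV s).trans (Finset.sum_congr rfl fun a _ => ?_)⟩
  ring

/-- The soft Bellman operator. -/
noncomputable def softBellman (M : MOMDP S A m) (r π₀ : S → A → ℝ) (α : ℝ) (V : S → ℝ) (s : S) :
    ℝ :=
  softSup α (π₀ s) fun a => r s a + M.γ * M.next V s a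

variable [Nonempty A] {M : MOMDP S A m} {r π₀ : S → A → ℝ} {α : ℝ}

theorem softBellman_le_add (hα : 0 < α) (hπ₀ : ∀ s a, 0 < π₀ s a) {p : S → Prop}
    (hp : M.IsClosedSet p) {V W : S → ℝ} {δ : ℝ} (h : ∀ s, p s → V s ≤ W s + δ) {s : S}
    (hs : p s) : M.softBellman r π₀ α V s ≤ M.softBellman r π₀ α W s + M.γ * δ := by
  refine softSup_le_add hα (hπ₀ s) fun a => ?_
  have h1 := M.next_mono hp h hs a
  have h2 : M.next (fun s => W s + δ) s a = M.next W s a + δ := by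
    have := M.next_sub W (fun _ => -δ) s a
    simpa only [next_const, sub_neg_eq_add] using this
  rw [h2] at h1
  nlinarith [M.γ_pos]

theorem exists_softBellman_fixedPoint (hα : 0 < α) (hπ₀ : ∀ s a, 0 < π₀ s a) :
    ∃ V : S → ℝ, M.softBellman r π₀ α V = V := by
  have hc : ContractingWith ⟨M.γ, M.γ_pos.le⟩ (M.softBellman r π₀ α) := by
    refine ⟨by exact_mod_cast M.γ_lt_one, LipschitzWith.of_dist_le_mul fun V W => ?_⟩
    refine (dist_pi_le_iff (mul_nonneg M.γ_pos.le dist_nonneg)).2 fun s => ?_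
    have h1 : ∀ x, |V x - W x| ≤ dist V W := fun x => by
      rw [← Real.dist_eq]
      exact dist_le_pi_dist V W x
    rw [Real.dist_eq, abs_sub_le_iff]
    constructor
    · have := softBellman_le_add (r := r) hα hπ₀ M.isClosedSet_true (V := V) (W := W) (δ := dist V W)
        (fun x _ => by linarith [(abs_sub_le_iff.1 (h1 x)).1]) (s := s) trivial
      change _ ≤ M.γ * dist V W
      linarith
    · have := softBellman_le_add (r := r) hα hπ₀ M.isClosedSet_true (V := W) (W := V) (δ := dist V W)
        (fun x _ => by linarith [(abs_sub_le_iff.1 (h1 x)).2]) (s := s) trivial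
      change _ ≤ M.γ * dist V W
      linarith
  exact ⟨_, hc.fixedPoint_isFixedPt⟩

theorem softBellman_fixedPoint_le (hα : 0 < α) (hπ₀ : ∀ s a, 0 < π₀ s a) (h1 : IsPolicy π₀)
    {V : S → ℝ} (hV : M.softBellman r π₀ α V = V) {u : ℝ} (hu : ∀ s a, r s a ≤ u) (s : S) :
    V s ≤ u / (1 - M.γ) := by
  obtain ⟨s₀, -, hmax⟩ := Finset.exists_max_image Finset.univ V ⟨s, Finset.mem_univ s⟩
  refine (hmax s (Finset.mem_univ s)).trans ?_
  rw [le_div_iff₀ M.one_sub_γ_pos]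
  have h2 : V s₀ ≤ u + M.γ * V s₀ := by
    nth_rewrite 1 [← hV]
    refine softSup_le hα (hπ₀ s₀) (h1 s₀).2 fun a => add_le_add (hu s₀ a) ?_
    refine mul_le_mul_of_nonneg_left ?_ M.γ_pos.le
    simpa [next_const] using
      M.next_mono M.isClosedSet_true (W := fun _ => V s₀)
        (fun x _ => hmax x (Finset.mem_univ x)) (s := s₀) trivial a
  linarith

theorem IsRegBellman.le_softBellman (hα : 0 < α) (hπ₀ : ∀ s a, 0 < π₀ s a) {π : S → A → ℝ}
    (hπ : IsPolicy π) {V : S → ℝ} (hV : M.IsRegBellman r π₀ α π V) (s : S) :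
    V s ≤ M.softBellman r π₀ α V s :=
  (hV s).trans_le (sum_mul_sub_log_le hα (hπ₀ s) _ (hπ s))

/-- By the variational principle, `W` is a supersolution of the Bellman equation of `π`; the minimum
principle applies to `W - V`. -/
theorem IsRegBellman.le_fixedPoint (hα : 0 < α) (hπ₀ : ∀ s a, 0 < π₀ s a) {π : S → A → ℝ}
    (hπ : IsPolicy π) {V W : S → ℝ} (hV : M.IsRegBellman r π₀ α π V)
    (hW : M.softBellman r π₀ α W = W) (s : S) : V s ≤ W s := by
  refine sub_nonneg.1 (M.nonneg_of_next_le M.isClosedSet_true hπ (W := fun s => W s - V s)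
    (fun s _ => ?_) s trivial)
  have h1 : ∑ a, π s a * (r s a + M.γ * M.next W s a - α * Real.log (π s a / π₀ s a)) ≤ W s := by
    conv_rhs => rw [← hW]
    exact sum_mul_sub_log_le hα (hπ₀ s) _ (hπ s)
  have h2 : ∑ a, π s a * (M.γ * M.next (fun s => W s - V s) s a) =
      ∑ a, π s a * (r s a + M.γ * M.next W s a - α * Real.log (π s a / π₀ s a)) - V s := by
    rw [hV s, ← Finset.sum_sub_distrib]
    refine Finset.sum_congr rfl fun a _ => ?_
    rw [next_sub]
    ring
  linarith

/-- Soft policy improvement at the reachable states. -/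
theorem IsRegBellman.softBellman_le (hα : 0 < α) (hπ₀ : ∀ s a, 0 < π₀ s a) {π π' : S → A → ℝ}
    (hπ : IsPolicy π) (hπ' : IsPolicy π') {V V' : S → ℝ} (hV : M.IsRegBellman r π₀ α π V)
    (hV' : M.IsRegBellman r π₀ α π' V')
    (h : ∀ s, M.Reachable s → π' s = tilt α (π₀ s) fun a => r s a + M.γ * M.next V s a) (s : S)
    (hs : M.Reachable s) : M.softBellman r π₀ α V s ≤ V' s := by
  -- The tilt attains the supremum defining the soft Bellman operator at `V`, so `V'` differs from
  -- it only through the discounted continuation of `V' - V`.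
  have key : ∀ s, M.Reachable s → V' s =
      M.softBellman r π₀ α V s + ∑ a, π' s a * (M.γ * M.next (fun s => V' s - V s) s a) := by
    intro s hs
    have h1 : M.softBellman r π₀ α V s =
        ∑ a, π' s a * (r s a + M.γ * M.next V s a - α * Real.log (π' s a / π₀ s a)) := by
      rw [h s hs]
      simp only [sub_log_tilt hα (hπ₀ s) fun a => r s a + M.γ * M.next V s a]
      rw [← Finset.sum_mul, (tilt_mem (hπ₀ s) _).2, one_mul]
      rfl
    rw [hV' s, h1, ← Finset.sum_add_distrib]
    refine Finset.sum_congr rfl fun a _ => ?_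
    rw [next_sub]
    ring
  have hmono : ∀ s, M.Reachable s → 0 ≤ V' s - V s :=
    M.nonneg_of_next_le M.isClosedSet_reachable hπ' fun s hs => by
      linarith [key s hs, hV.le_softBellman hα hπ₀ hπ s]
  rw [key s hs]
  refine le_add_of_nonneg_right (Finset.sum_nonneg fun a _ => mul_nonneg ((hπ' s).1 a)
    (mul_nonneg M.γ_pos.le ?_))
  simpa [next_const] using
    M.next_mono M.isClosedSet_reachable (V := fun _ => (0 : ℝ)) hmono hs a

/-- With `T` the soft Bellman operator, `W = T W ≤ T V + γ δ ≤ V' + γ δ` on reachable states: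
contraction, then policy improvement. -/
theorem IsRegBellman.fixedPoint_le_add (hα : 0 < α) (hπ₀ : ∀ s a, 0 < π₀ s a)
    {π π' : S → A → ℝ} (hπ : IsPolicy π) (hπ' : IsPolicy π') {V V' W : S → ℝ}
    (hV : M.IsRegBellman r π₀ α π V) (hV' : M.IsRegBellman r π₀ α π' V')
    (h : ∀ s, M.Reachable s → π' s = tilt α (π₀ s) fun a => r s a + M.γ * M.next V s a)
    (hW : M.softBellman r π₀ α W = W) {δ : ℝ} (hδ : ∀ s, M.Reachable s → W s ≤ V s + δ) (s : S)
    (hs : M.Reachable s) : W s ≤ V' s + M.γ * δ := by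
  have h1 := softBellman_le_add (r := r) hα hπ₀ M.isClosedSet_reachable hδ hs
  rw [hW] at h1
  linarith [hV.softBellman_le hα hπ₀ hπ hπ' hV' h s hs]

/-- The approximate three-point inequality for one step of soft policy iteration. -/
theorem regValue_tilt_ge (hα : 0 < α) (hπ₀ : ∀ s a, 0 < π₀ s a)
    {π π' : S → A → ℝ} (hπ : IsPolicy π) (hπ' : IsPolicy π') {V W : S → ℝ}
    (hV : M.IsRegBellman r π₀ α π V)
    (h : ∀ s, M.Reachable s → π' s = tilt α (π₀ s) fun a => r s a + M.γ * M.next V s a)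
    (hW : M.softBellman r π₀ α W = W) {δ : ℝ} (hδ : ∀ s, M.Reachable s → W s ≤ V s + δ)
    {ν : S → A → ℝ} (hν : IsPolicy ν) :
    M.regValue r π₀ α ν + α / (1 - M.γ) * policyKL (M.stateVisit ν) ν π' ≤
      M.regValue r π₀ α π' + M.γ * δ / (1 - M.γ) := by
  obtain ⟨V', hV'⟩ := M.exists_isRegBellman hπ' r π₀ α
  have h1 : ∑ s, M.ρ s * M.softBellman r π₀ α V s ≤ M.regValue r π₀ α π' := by
    rw [M.regValue_eq_of_bellman hπ' hV']
    refine Finset.sum_le_sum fun s _ => ?_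
    rcases (M.ρ_mem.1 s).eq_or_lt with h0 | h0
    · simp [← h0]
    · exact mul_le_mul_of_nonneg_left
        (hV.softBellman_le hα hπ₀ hπ hπ' hV' h s (.init h0)) h0.le
  -- Monotonicity and `V ≤ W` bound the improvement of one soft Bellman update by the remaining gap
  -- `δ`.
  have hT : ∀ s, M.Reachable s → M.softBellman r π₀ α V s ≤ V s + δ := fun s hs => by
    have h2 := softBellman_le_add (r := r) hα hπ₀ M.isClosedSet_true (V := V) (W := W) (δ := 0)
      (fun x _ => by simpa using hV.le_fixedPoint hα hπ₀ hπ hW x) (s := s) trivial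
    rw [hW] at h2
    linarith [hδ s hs]
  -- The reference function of the performance difference identity is the soft Bellman update of
  -- `V`. Exchanging it for `V` in the continuation costs `γ δ`, and the Gibbs identity then
  -- produces the KL term.
  have h3 : ∀ s, M.stateVisit ν s * (∑ a, ν s a * (r s a +
        M.γ * M.next (M.softBellman r π₀ α V) s a - α * Real.log (ν s a / π₀ s a)) -
        M.softBellman r π₀ α V s) ≤
      M.stateVisit ν s * (M.γ * δ) - α * (M.stateVisit ν s * klVec (ν s) (π' s)) := by
    intro s
    by_cases hs : M.Reachable s
    · have h4 := sum_mul_sub_log hα (hπ₀ s) (fun a => r s a + M.γ * M.next V s a) (hν s)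
      rw [← h s hs] at h4
      have h5 : ∑ a, ν s a * (r s a +
          M.γ * M.next (M.softBellman r π₀ α V) s a - α * Real.log (ν s a / π₀ s a)) ≤
          ∑ a, (ν s a * (r s a + M.γ * M.next V s a - α * Real.log (ν s a / π₀ s a)) +
            ν s a * (M.γ * δ)) := by
        refine Finset.sum_le_sum fun a _ => ?_
        rw [← mul_add]
        refine mul_le_mul_of_nonneg_left ?_ ((hν s).1 a)
        have h6 := M.next_mono M.isClosedSet_reachable
          (fun x hx => sub_le_iff_le_add'.2 (hT x hx)) hs a
        rw [next_sub, next_const] at h6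
        nlinarith [M.γ_pos]
      rw [Finset.sum_add_distrib, ← Finset.sum_mul, (hν s).2, one_mul, h4] at h5
      have h7 := mul_le_mul_of_nonneg_left h5 (M.stateVisit_nonneg hν s)
      rw [mul_sub]
      unfold softBellman at h7 ⊢
      linarith
    · simp [M.stateVisit_eq_zero hν hs]
  have h8 := Finset.sum_le_sum fun s (_ : s ∈ Finset.univ) => h3 s
  rw [Finset.sum_sub_distrib, ← Finset.sum_mul, M.sum_stateVisit hν, one_mul,
    ← Finset.mul_sum] at h8
  have h9 := mul_le_mul_of_nonneg_left h8 (inv_nonneg.2 M.one_sub_γ_pos.le)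
  rw [M.regValue_eq_add hν r π₀ α (M.softBellman r π₀ α V), policyKL, div_eq_mul_inv,
    div_eq_mul_inv]
  linarith

variable [DecidableEq S] [DecidableEq A]

/-- The inner loop approximately solves the regularized problem. -/
theorem regValue_innerLoop_ge (M : MOMDP S A m) {r : S → A → ℝ} {α L : ℝ} (hα : 0 < α)
    (hr : ∀ s a, |r s a| ≤ L) (θ : S × A → ℝ) {t : ℕ} (ht : 1 ≤ t) {ν : S → A → ℝ}
    (hν : IsPolicy ν) :
    M.regValue r (softmax θ) α ν + α / (1 - M.γ) * policyKL (M.stateVisit ν) ν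
        (softmax (M.innerLoop r θ α ((1 - M.γ) / α) t)) ≤
      M.regValue r (softmax θ) α (softmax (M.innerLoop r θ α ((1 - M.γ) / α) t)) +
        M.γ ^ t * (2 * L / (1 - M.γ)) / (1 - M.γ) := by
  let ϑ : ℕ → S × A → ℝ := fun j => M.innerLoop r θ α ((1 - M.γ) / α) j
  have hstep : ∀ j, ϑ (j + 1) = M.npgStep r (softmax θ) α ((1 - M.γ) / α) (ϑ j) := fun j =>
    Function.iterate_succ_apply' _ _ _
  choose V hV using fun j => M.exists_isRegBellman (isPolicy_softmax (ϑ j)) r (softmax θ) α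
  have hpos := softmax_pos θ
  have htilt : ∀ j s, M.Reachable s → softmax (ϑ (j + 1)) s =
      tilt α (softmax θ s) fun a => r s a + M.γ * M.next (V j) s a := fun j s hs => by
    funext a
    rw [hstep]
    exact M.softmax_npgStep hpos hα (hV j) hs a
  obtain ⟨W, hW⟩ := exists_softBellman_fixedPoint (M := M) (r := r) hα hpos
  -- The loop starts at its own anchor, where the penalty vanishes: then `V 0 ≥ -L / (1 - γ)`, while
  -- `W ≤ L / (1 - γ)`.
  have hgap : ∀ j s, M.Reachable s → W s ≤ V j s + M.γ ^ j * (2 * L / (1 - M.γ)) := by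
    intro j
    induction j with
    | zero =>
      intro s _
      have h1 := softBellman_fixedPoint_le hα hpos (isPolicy_softmax θ) hW
        (fun s a => (abs_le.1 (hr s a)).2) s
      have h2 := M.le_of_bellman (isPolicy_softmax θ) (c := r) (V := V 0) (fun s => by
        have h3 : V 0 s = ∑ a, softmax θ s a * (r s a + M.γ * M.next (V 0) s a -
          α * Real.log (softmax θ s a / softmax θ s a)) := hV 0 s
        simpa [div_self (hpos s _).ne'] using h3) (fun s a => (abs_le.1 (hr s a)).1) s
      rw [neg_div] at h2
      rw [pow_zero, one_mul, two_mul, add_div]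
      linarith
    | succ j ih =>
      intro s hs
      have := (hV j).fixedPoint_le_add hα hpos (isPolicy_softmax _) (isPolicy_softmax _)
        (hV (j + 1)) (htilt j) hW ih s hs
      rwa [← mul_assoc, ← pow_succ'] at this
  -- The three-point inequality concerns a tilted policy, so at least one step is needed. The last
  -- step supplies the final factor `γ`.
  obtain ⟨n, rfl⟩ := Nat.exists_eq_add_of_le' ht
  have := regValue_tilt_ge hα hpos (isPolicy_softmax _) (isPolicy_softmax _) (hV n) (htilt n) hW
    (hgap n) hν
  rwa [← mul_assoc M.γ, ← pow_succ'] at this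

end MOMDP

/-! ### First-order bounds for the objective -/

section Box

variable {m : ℕ} {γ : ℝ} {F : (Fin m → ℝ) → ℝ}

theorem convex_valueBox (m : ℕ) (γ : ℝ) : Convex ℝ (valueBox m γ) := convex_Icc _ _

theorem lineMap_mem_valueBox {v w : Fin m → ℝ} (hv : v ∈ valueBox m γ) (hw : w ∈ valueBox m γ)
    {t : ℝ} (ht : t ∈ Set.Icc (0 : ℝ) 1) : AffineMap.lineMap v w t ∈ valueBox m γ :=
  (convex_valueBox m γ).lineMap_mem hv hw ht

theorem hasDerivWithinAt_comp_lineMap (hF : DifferentiableOn ℝ F (valueBox m γ))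
    {v w : Fin m → ℝ} (hv : v ∈ valueBox m γ) (hw : w ∈ valueBox m γ) {t : ℝ}
    (ht : t ∈ Set.Icc (0 : ℝ) 1) :
    HasDerivWithinAt (fun t : ℝ => F (AffineMap.lineMap v w t))
      (∑ i, gradF γ F (AffineMap.lineMap v w t) i * (w i - v i)) (Set.Icc 0 1) t := by
  have h1 := (hF _ (lineMap_mem_valueBox hv hw ht)).hasFDerivWithinAt
  have h2 : HasDerivWithinAt (fun t : ℝ => AffineMap.lineMap v w t) (w - v) (Set.Icc 0 1) t :=
    AffineMap.hasDerivWithinAt_lineMap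
  have h3 := h1.comp_hasDerivWithinAt t h2 fun x hx => lineMap_mem_valueBox hv hw hx
  rw [← sum_apply_single_mul] at h3
  exact h3

theorem le_add_gradF (hc : ConcaveOn ℝ (valueBox m γ) F)
    (hF : DifferentiableOn ℝ F (valueBox m γ)) {v w : Fin m → ℝ} (hv : v ∈ valueBox m γ)
    (hw : w ∈ valueBox m γ) : F w ≤ F v + ∑ i, gradF γ F v i * (w i - v i) := by
  have h0 : (0 : ℝ) ∈ Set.Icc (0 : ℝ) 1 := ⟨le_rfl, zero_le_one⟩
  have h1 : (1 : ℝ) ∈ Set.Icc (0 : ℝ) 1 := ⟨zero_le_one, le_rfl⟩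
  have hconc : ConcaveOn ℝ (Set.Icc (0 : ℝ) 1) (fun t : ℝ => F (AffineMap.lineMap v w t)) :=
    (hc.comp_affineMap (AffineMap.lineMap v w)).subset
      (fun t ht => lineMap_mem_valueBox hv hw ht) (convex_Icc 0 1)
  have h2 := hconc.slope_le_of_hasDerivWithinAt h0 h1 zero_lt_one
    (hasDerivWithinAt_comp_lineMap hF hv hw h0)
  simp only [slope_def_field, AffineMap.lineMap_apply_one, AffineMap.lineMap_apply_zero, sub_zero,
    div_one] at h2
  linarith

/-- The mean value theorem on the segment, with the gradient at the intermediate point compared to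
that at `v`. It gives `β` rather than `β / 2`, which the lower bound on `α` can afford. -/
theorem add_gradF_le {β : ℝ} (hβ : 0 < β) (hs : IsSmoothWrtSup γ β F) {v w : Fin m → ℝ}
    (hv : v ∈ valueBox m γ) (hw : w ∈ valueBox m γ) :
    F v + ∑ i, gradF γ F v i * (w i - v i) - β * ‖w - v‖ ^ 2 ≤ F w := by
  have hd := fun t (ht : t ∈ Set.Icc (0 : ℝ) 1) => hasDerivWithinAt_comp_lineMap hs.1 hv hw ht
  obtain ⟨c, hc, hslope⟩ := exists_hasDerivAt_eq_slope
    (fun t : ℝ => F (AffineMap.lineMap v w t)) _ zero_lt_one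
    (fun t ht => (hd t ht).continuousWithinAt)
    (fun t ht => (hd t (Set.Ioo_subset_Icc_self ht)).hasDerivAt (Icc_mem_nhds ht.1 ht.2))
  simp only [AffineMap.lineMap_apply_one, AffineMap.lineMap_apply_zero, sub_zero, div_one]
    at hslope
  have hcI := Set.Ioo_subset_Icc_self hc
  have hdist : ‖v - AffineMap.lineMap v w c‖ ≤ ‖w - v‖ := by
    rw [← dist_eq_norm, dist_left_lineMap, Real.norm_of_nonneg hcI.1, dist_comm, dist_eq_norm]
    exact mul_le_of_le_one_left (norm_nonneg _) hcI.2
  have h1 : ∑ i, (gradF γ F v i - gradF γ F (AffineMap.lineMap v w c) i) * (w i - v i) ≤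
      β * ‖w - v‖ ^ 2 := by
    calc _ ≤ ∑ i, |gradF γ F v i - gradF γ F (AffineMap.lineMap v w c) i| * ‖w - v‖ := by
          refine Finset.sum_le_sum fun i _ => (le_abs_self _).trans ?_
          rw [abs_mul]
          exact mul_le_mul_of_nonneg_left (norm_le_pi_norm (w - v) i) (abs_nonneg _)
      _ ≤ β * ‖w - v‖ * ‖w - v‖ := by
          rw [← Finset.sum_mul]
          exact mul_le_mul_of_nonneg_right ((hs.2 v hv _ (lineMap_mem_valueBox hv hw hcI)).trans
            (mul_le_mul_of_nonneg_left hdist hβ.le)) (norm_nonneg _)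
      _ = _ := by ring
  simp only [sub_mul, Finset.sum_sub_distrib] at h1
  linarith

end Box

theorem isCompact_isPolicy {S A : Type*} [Fintype A] : IsCompact {π : S → A → ℝ | IsPolicy π} := by
  have h : {π : S → A → ℝ | IsPolicy π} = Set.univ.pi fun _ => stdSimplex ℝ A := by
    ext π
    simp [IsPolicy]
  rw [h]
  exact isCompact_univ_pi fun _ => isCompact_stdSimplex ℝ A

/-! ### From KL divergence to values, and the minorization of the objective -/

namespace MOMDP

variable {S A : Type*} [Fintype S] [Fintype A] {m : ℕ}

theorem policyKL_stateVisit_nonneg (M : MOMDP S A m) {ν π π' : S → A → ℝ} (hν : IsPolicy ν)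
    (hπ : IsPolicy π) (hπ' : IsPolicy π') (hpos : ∀ s a, 0 < π' s a) :
    0 ≤ policyKL (M.stateVisit ν) π π' :=
  Finset.sum_nonneg fun s _ => mul_nonneg (M.stateVisit_nonneg hν s)
    (klVec_nonneg (hπ s) (hπ' s) (hpos s))

/-- Both vectors have the same mass, so `q` may be centered at `u / 2`. The half gained here offsets
the constant 4 in the Pinsker inequality. -/
theorem abs_sum_sub_mul_le {x y q : A → ℝ} (hx : x ∈ stdSimplex ℝ A) (hy : y ∈ stdSimplex ℝ A)
    {u : ℝ} (hq : ∀ a, q a ∈ Set.Icc 0 u) :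
    |∑ a, (x a - y a) * q a| ≤ u / 2 * ∑ a, |x a - y a| := by
  have h : ∑ a, (x a - y a) * q a = ∑ a, (x a - y a) * (q a - u / 2) := by
    simp only [mul_sub, Finset.sum_sub_distrib, ← Finset.sum_mul, hx.2, hy.2, sub_self, zero_mul,
      sub_zero]
  rw [h, Finset.mul_sum]
  refine (Finset.abs_sum_le_sum_abs _ _).trans (Finset.sum_le_sum fun a _ => ?_)
  rw [abs_mul, mul_comm]
  refine mul_le_mul_of_nonneg_right (abs_le.2 ⟨?_, ?_⟩) (abs_nonneg _) <;>
    linarith [(hq a).1, (hq a).2]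

/-- The performance difference identity integrates `π' - π` against an action value in `[0, 1 / (1 -
γ)]`; Pinsker in each state and Cauchy-Schwarz over states do the rest. -/
theorem sq_value_sub_le (M : MOMDP S A m) {π π' : S → A → ℝ} (hπ : IsPolicy π)
    (hπ' : IsPolicy π') (hpos : ∀ s a, 0 < π s a) {r : S → A → ℝ}
    (hr : ∀ s a, r s a ∈ Set.Icc (0 : ℝ) 1) :
    (M.value r π' - M.value r π) ^ 2 ≤
      policyKL (M.stateVisit π') π' π / (1 - M.γ) ^ 4 := by
  have hγ := M.one_sub_γ_pos
  obtain ⟨V, hV⟩ := M.exists_bellman hπ r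
  have hV0 : ∀ s, 0 ≤ V s := fun s => by
    simpa using M.le_of_bellman hπ hV (fun s a => (hr s a).1) s
  have hV1 := M.bellman_le hπ hV (fun s a => (hr s a).2)
  have hQ : ∀ s a, r s a + M.γ * M.next V s a ∈ Set.Icc 0 (1 / (1 - M.γ)) := by
    intro s a
    have h0 := M.next_mono M.isClosedSet_true (V := fun _ => (0 : ℝ)) (fun x _ => hV0 x)
      (s := s) trivial a
    have h1 := M.next_mono M.isClosedSet_true (fun x _ => hV1 x) (s := s) trivial a
    rw [next_const] at h0 h1
    refine ⟨add_nonneg (hr s a).1 (mul_nonneg M.γ_pos.le h0), ?_⟩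
    have h2 : 1 + M.γ * (1 / (1 - M.γ)) = 1 / (1 - M.γ) := by
      field_simp
      ring
    rw [← h2]
    exact add_le_add (hr s a).2 (mul_le_mul_of_nonneg_left h1 M.γ_pos.le)
  have hdiff : M.value r π' - M.value r π = (1 - M.γ)⁻¹ * ∑ s, M.stateVisit π' s *
      ∑ a, (π' s a - π s a) * (r s a + M.γ * M.next V s a) := by
    have h1 : M.value r π = ∑ s, M.ρ s * V s := by
      rw [← M.regValue_zero r π π, M.regValue_eq_of_bellman hπ (by simpa using hV)]
    rw [h1, ← M.regValue_zero r π π', M.regValue_eq_add hπ' r π 0 V, add_sub_cancel_left]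
    congr 1
    refine Finset.sum_congr rfl fun s _ => ?_
    congr 1
    rw [hV s, ← Finset.sum_sub_distrib]
    exact Finset.sum_congr rfl fun a _ => by ring
  have habs : |M.value r π' - M.value r π| ≤ (1 - M.γ)⁻¹ * (1 / (1 - M.γ) / 2) *
      ∑ s, M.stateVisit π' s * ∑ a, |π' s a - π s a| := by
    rw [hdiff, abs_mul, abs_of_pos (inv_pos.2 hγ), mul_assoc]
    refine mul_le_mul_of_nonneg_left ?_ (inv_pos.2 hγ).le
    rw [Finset.mul_sum]
    refine (Finset.abs_sum_le_sum_abs _ _).trans (Finset.sum_le_sum fun s _ => ?_)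
    rw [abs_mul, abs_of_nonneg (M.stateVisit_nonneg hπ' s), mul_left_comm]
    exact mul_le_mul_of_nonneg_left (abs_sum_sub_mul_le (hπ' s) (hπ s) (hQ s))
      (M.stateVisit_nonneg hπ' s)
  have hcs : (∑ s, M.stateVisit π' s * ∑ a, |π' s a - π s a|) ^ 2 ≤
      4 * policyKL (M.stateVisit π') π' π := by
    have h1 := Finset.sum_sq_le_sum_mul_sum_of_sq_le_mul Finset.univ
      (r := fun s => M.stateVisit π' s * ∑ a, |π' s a - π s a|)
      (f := M.stateVisit π') (g := fun s => M.stateVisit π' s * (∑ a, |π' s a - π s a|) ^ 2)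
      (fun s _ => M.stateVisit_nonneg hπ' s)
      (fun s _ => mul_nonneg (M.stateVisit_nonneg hπ' s) (sq_nonneg _)) (fun s _ => le_of_eq (by ring))
    rw [M.sum_stateVisit hπ', one_mul] at h1
    refine h1.trans ?_
    rw [policyKL, Finset.mul_sum]
    refine Finset.sum_le_sum fun s _ => ?_
    rw [mul_left_comm]
    exact mul_le_mul_of_nonneg_left (sq_sum_abs_sub_le_klVec (hπ' s) (hπ s) (hpos s))
      (M.stateVisit_nonneg hπ' s)
  calc (M.value r π' - M.value r π) ^ 2 = |M.value r π' - M.value r π| ^ 2 := (sq_abs _).symm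
    _ ≤ ((1 - M.γ)⁻¹ * (1 / (1 - M.γ) / 2) *
          ∑ s, M.stateVisit π' s * ∑ a, |π' s a - π s a|) ^ 2 :=
        pow_le_pow_left₀ (abs_nonneg _) habs 2
    _ ≤ ((1 - M.γ)⁻¹ * (1 / (1 - M.γ) / 2)) ^ 2 * (4 * policyKL (M.stateVisit π') π' π) := by
        rw [mul_pow]
        exact mul_le_mul_of_nonneg_left hcs (sq_nonneg _)
    _ = _ := by
        field_simp
        norm_num

theorem sq_norm_valueVec_sub_le (M : MOMDP S A m) {π π' : S → A → ℝ} (hπ : IsPolicy π)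
    (hπ' : IsPolicy π') (hpos : ∀ s a, 0 < π s a) :
    ‖M.valueVec π' - M.valueVec π‖ ^ 2 ≤ policyKL (M.stateVisit π') π' π / (1 - M.γ) ^ 4 := by
  have hD := M.policyKL_stateVisit_nonneg hπ' hπ' hπ hpos
  rw [← Real.le_sqrt (norm_nonneg _) (div_nonneg hD (pow_pos M.one_sub_γ_pos 4).le)]
  refine (pi_norm_le_iff_of_nonneg (Real.sqrt_nonneg _)).2 fun i => ?_
  exact Real.abs_le_sqrt (M.sq_value_sub_le hπ hπ' hpos (M.r_mem i))

theorem value_ascentReward (M : MOMDP S A m) (F : (Fin m → ℝ) → ℝ) (π : S → A → ℝ)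
    {ν : S → A → ℝ} (hν : IsPolicy ν) :
    M.value (M.ascentReward F π) ν =
      ∑ i, gradF M.γ F (M.valueVec π) i * M.valueVec ν i := by
  simp only [valueVec, ascentReward, M.value_eq hν, Finset.mul_sum]
  rw [Finset.sum_comm (s := (Finset.univ : Finset (Fin m)))]
  refine Finset.sum_congr rfl fun s _ => ?_
  rw [Finset.sum_comm (s := (Finset.univ : Finset (Fin m)))]
  exact Finset.sum_congr rfl fun a _ => Finset.sum_congr rfl fun i _ => by ring

theorem abs_ascentReward_le (M : MOMDP S A m) {F : (Fin m → ℝ) → ℝ} {π : S → A → ℝ} {L : ℝ}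
    (hL : ∑ i, |gradF M.γ F (M.valueVec π) i| ≤ L) (s : S) (a : A) :
    |M.ascentReward F π s a| ≤ L := by
  refine (Finset.abs_sum_le_sum_abs _ _).trans ((Finset.sum_le_sum fun i _ => ?_).trans hL)
  rw [abs_mul, abs_of_nonneg (M.r_mem i s a).1]
  exact mul_le_of_le_one_right (abs_nonneg _) (M.r_mem i s a).2

theorem le_add_value_ascentReward (M : MOMDP S A m) {F : (Fin m → ℝ) → ℝ}
    (hc : ConcaveOn ℝ (valueBox m M.γ) F) (hF : DifferentiableOn ℝ F (valueBox m M.γ))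
    {π ν : S → A → ℝ} (hπ : IsPolicy π) (hν : IsPolicy ν) :
    F (M.valueVec ν) ≤ F (M.valueVec π) +
      (M.value (M.ascentReward F π) ν - M.value (M.ascentReward F π) π) := by
  have h := le_add_gradF hc hF (M.valueVec_mem hπ) (M.valueVec_mem hν)
  simpa only [M.value_ascentReward F π hν, M.value_ascentReward F π hπ, mul_sub,
    Finset.sum_sub_distrib] using h

/-- A crude bound, needed for macro steps that contain no micro step. -/
theorem sub_le_of_gradF (M : MOMDP S A m) {F : (Fin m → ℝ) → ℝ} {L : ℝ}
    (hF : ConcaveOn ℝ (valueBox m M.γ) F) (hd : DifferentiableOn ℝ F (valueBox m M.γ))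
    {π ν : S → A → ℝ} (hπ : IsPolicy π) (hν : IsPolicy ν)
    (hL : ∑ i, |gradF M.γ F (M.valueVec π) i| ≤ L) :
    F (M.valueVec ν) - F (M.valueVec π) ≤ L / (1 - M.γ) := by
  have hv := M.valueVec_mem hπ
  have hw := M.valueVec_mem hν
  have h1 := le_add_gradF hF hd hv hw
  have h2 : ∑ i, gradF M.γ F (M.valueVec π) i * (M.valueVec ν i - M.valueVec π i) ≤
      ∑ i, |gradF M.γ F (M.valueVec π) i| * (1 / (1 - M.γ)) := by
    refine Finset.sum_le_sum fun i _ => (le_abs_self _).trans ?_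
    rw [abs_mul]
    refine mul_le_mul_of_nonneg_left (abs_le.2 ⟨?_, ?_⟩) (abs_nonneg _)
    · have h3 : 0 ≤ M.valueVec ν i := hw.1 i
      have h4 : M.valueVec π i ≤ 1 / (1 - M.γ) := hv.2 i
      linarith
    · have h3 : 0 ≤ M.valueVec π i := hv.1 i
      have h4 : M.valueVec ν i ≤ 1 / (1 - M.γ) := hw.2 i
      linarith
  rw [← Finset.sum_mul] at h2
  have h5 := mul_le_mul_of_nonneg_right hL (one_div_nonneg.2 M.one_sub_γ_pos.le)
  rw [mul_one_div L] at h5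
  linarith

/-- The regularized linearization minorizes the objective. -/
theorem add_regValue_ascentReward_le (M : MOMDP S A m) {F : (Fin m → ℝ) → ℝ} {α β : ℝ}
    (hβ : 0 < β) (hs : IsSmoothWrtSup M.γ β F) (hα : β / (1 - M.γ) ^ 3 ≤ α)
    {π π' : S → A → ℝ} (hπ : IsPolicy π) (hπ' : IsPolicy π') (hpos : ∀ s a, 0 < π s a) :
    F (M.valueVec π) + (M.regValue (M.ascentReward F π) π α π' -
      M.value (M.ascentReward F π) π) ≤ F (M.valueVec π') := by
  have hγ := M.one_sub_γ_pos
  have h := add_gradF_le hβ hs (M.valueVec_mem hπ) (M.valueVec_mem hπ')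
  simp only [mul_sub, Finset.sum_sub_distrib, ← M.value_ascentReward F π hπ',
    ← M.value_ascentReward F π hπ] at h
  have hD := M.policyKL_stateVisit_nonneg hπ' hπ' hπ hpos
  have h1 : β * ‖M.valueVec π' - M.valueVec π‖ ^ 2 ≤
      α * (policyKL (M.stateVisit π') π' π / (1 - M.γ)) := by
    calc β * ‖M.valueVec π' - M.valueVec π‖ ^ 2
        ≤ β * (policyKL (M.stateVisit π') π' π / (1 - M.γ) ^ 4) :=
          mul_le_mul_of_nonneg_left (M.sq_norm_valueVec_sub_le hπ hπ' hpos) hβ.le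
      _ = β / (1 - M.γ) ^ 3 * (policyKL (M.stateVisit π') π' π / (1 - M.γ)) := by
          field_simp
      _ ≤ _ := mul_le_mul_of_nonneg_right hα (div_nonneg hD hγ.le)
  rw [regValue]
  linarith

theorem exists_isOptimal [Nonempty A] (M : MOMDP S A m) {F : (Fin m → ℝ) → ℝ}
    (hF : ContinuousOn F (valueBox m M.γ)) : ∃ π, M.IsOptimal F π := by
  have hcont : ContinuousOn (fun π : S → A → ℝ => F (M.valueVec π)) {π | IsPolicy π} :=
    hF.comp (continuousOn_pi.2 fun i => M.continuousOn_value (M.r i))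
      fun π hπ => M.valueVec_mem hπ
  obtain ⟨π, hπ, hmax⟩ := isCompact_isPolicy.exists_isMaxOn
    ⟨softmax (0 : S × A → ℝ), isPolicy_softmax 0⟩ hcont
  exact ⟨π, hπ, fun π' hπ' => hmax hπ'⟩

end MOMDP

/-! ### The macro step and the telescoping sum -/

namespace MOMDP

variable {S A : Type*} [Fintype S] [Fintype A] [DecidableEq S] [DecidableEq A] {m : ℕ}

/-- Progress of one macro step with at least one micro step. -/
theorem sub_le_of_innerLoop [Nonempty A] (M : MOMDP S A m) {F : (Fin m → ℝ) → ℝ} {α β L : ℝ}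
    (hF : ConcaveOn ℝ (valueBox m M.γ) F) (hβ : 0 < β) (hs : IsSmoothWrtSup M.γ β F)
    (hα : β / (1 - M.γ) ^ 3 ≤ α) (θ : S × A → ℝ)
    (hL : ∑ i, |gradF M.γ F (M.valueVec (softmax θ)) i| ≤ L) {t : ℕ} (ht : 1 ≤ t)
    {ν : S → A → ℝ} (hν : IsPolicy ν) {θ' : S × A → ℝ}
    (hθ' : θ' = M.innerLoop (M.ascentReward F (softmax θ)) θ α ((1 - M.γ) / α) t) :
    F (M.valueVec ν) - F (M.valueVec (softmax θ')) ≤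
      α / (1 - M.γ) * (policyKL (M.stateVisit ν) ν (softmax θ) -
        policyKL (M.stateVisit ν) ν (softmax θ')) + M.γ ^ t * (2 * L / (1 - M.γ) ^ 2) := by
  have hα0 : 0 < α := (div_pos hβ (pow_pos M.one_sub_γ_pos 3)).trans_le hα
  have h1 := M.le_add_value_ascentReward hF hs.1 (isPolicy_softmax θ) hν
  have h2 := M.add_regValue_ascentReward_le hβ hs hα (isPolicy_softmax θ) (isPolicy_softmax θ')
    (softmax_pos θ)
  have h3 := M.regValue_innerLoop_ge hα0 (M.abs_ascentReward_le hL) θ ht hν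
  rw [← hθ'] at h3
  have h4 : M.regValue (M.ascentReward F (softmax θ)) (softmax θ) α ν =
      M.value (M.ascentReward F (softmax θ)) ν -
        α / (1 - M.γ) * policyKL (M.stateVisit ν) ν (softmax θ) := by
    rw [regValue]
    ring
  have h5 : M.γ ^ t * (2 * L / (1 - M.γ)) / (1 - M.γ) = M.γ ^ t * (2 * L / (1 - M.γ) ^ 2) := by
    rw [sq, mul_div_assoc, div_div]
  rw [h4, h5] at h3
  rw [mul_sub]
  linarith

end MOMDP

theorem pow_le_inv_of_log_le {γ c : ℝ} (hγ0 : 0 < γ) (hγ1 : γ < 1) (hc : 0 < c) {t : ℕ}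
    (ht : 1 / (1 - γ) * Real.log c ≤ t) : γ ^ t ≤ c⁻¹ := by
  have h1 : 0 < 1 - γ := sub_pos.2 hγ1
  have h2 : γ ≤ Real.exp (-(1 - γ)) := by
    have := Real.add_one_le_exp (-(1 - γ))
    linarith
  rw [one_div_mul_eq_div, div_le_iff₀ h1] at ht
  calc γ ^ t ≤ Real.exp (-(1 - γ)) ^ t := pow_le_pow_left₀ hγ0.le h2 t
    _ = Real.exp (t * -(1 - γ)) := (Real.exp_nat_mul _ _).symm
    _ ≤ Real.exp (-Real.log c) := Real.exp_le_exp.2 (by linarith)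
    _ = c⁻¹ := by rw [Real.exp_neg, Real.exp_log hc]

theorem theorem1 {S A : Type*} [Fintype S] [Fintype A] [DecidableEq S] [DecidableEq A]
    [Nontrivial A] {m : ℕ} (M : MOMDP S A m)
    (F : (Fin m → ℝ) → ℝ) (β L : ℝ)
    (hF : ConcaveOn ℝ (valueBox m M.γ) F)
    (hβ : 0 < β) (hsmooth : IsSmoothWrtSup M.γ β F)
    (hL : 0 < L) (hgrad : ∀ v ∈ M.achievable, ∑ i, |gradF M.γ F v i| ≤ L)
    (K : ℕ) (hK : 1 ≤ K)
    (α : ℝ) (hα : β / (1 - M.γ) ^ 3 ≤ α)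
    (η : ℝ) (hη : η = (1 - M.γ) / α)
    (t : ℕ → ℕ)
    (ht : ∀ k < K, t k = ⌈1 / (1 - M.γ) *
      Real.log (5 * L * K / (β * Real.log (Fintype.card A))) + 1⌉₊)
    (θ₀ : S × A → ℝ) (hθ₀ : ∀ s a, softmax θ₀ s a = 1 / (Fintype.card A : ℝ))
    (π : ℕ → S → A → ℝ) (hπ : ∀ k, π k = softmax (M.arnpgIMD F α η t θ₀ k)) :
    (∃ πopt : S → A → ℝ, M.IsOptimal F πopt) ∧
    ∀ πopt : S → A → ℝ, M.IsOptimal F πopt →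
      F (M.valueVec πopt) -
          (Finset.Icc 1 K).sup' (Finset.nonempty_Icc.mpr hK) (fun k => F (M.valueVec (π k)))
        ≤ F (M.valueVec πopt) - (1 / (K : ℝ)) * ∑ k ∈ Finset.Icc 1 K, F (M.valueVec (π k)) ∧
      F (M.valueVec πopt) - (1 / (K : ℝ)) * ∑ k ∈ Finset.Icc 1 K, F (M.valueVec (π k))
        ≤ 2 * α * Real.log (Fintype.card A) / ((1 - M.γ) * K) := by
  have hγ := M.one_sub_γ_pos
  have hK0 : (0 : ℝ) < K := by exact_mod_cast hK
  have hlog : 0 < Real.log (Fintype.card A) :=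
    Real.log_pos (by exact_mod_cast Fintype.one_lt_card)
  have hα0 : 0 < α := (div_pos hβ (pow_pos hγ 3)).trans_le hα
  refine ⟨M.exists_isOptimal hsmooth.1.continuousOn, fun ν hν => ⟨?_, ?_⟩⟩
  · have h := Finset.sum_le_card_nsmul (Finset.Icc 1 K) (fun k => F (M.valueVec (π k)))
      ((Finset.Icc 1 K).sup' (Finset.nonempty_Icc.mpr hK) fun k => F (M.valueVec (π k)))
      fun k hk => Finset.le_sup' (fun k => F (M.valueVec (π k))) hk
    rw [Nat.card_Icc, Nat.add_sub_cancel, nsmul_eq_mul] at h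
    have h1 := mul_le_mul_of_nonneg_left h (one_div_pos.2 hK0).le
    rw [← mul_assoc, one_div_mul_cancel hK0.ne', one_mul] at h1
    exact sub_le_sub_left h1 _
  have hpol : ∀ k, IsPolicy (π k) := fun k => by
    rw [hπ]
    exact isPolicy_softmax _
  have hpos : ∀ k s a, 0 < π k s a := fun k => by
    rw [hπ]
    exact softmax_pos _
  let D : ℕ → ℝ := fun k => policyKL (M.stateVisit ν) ν (π k)
  let lA := Real.log (Fintype.card A)
  have hβα : β / (1 - M.γ) ≤ α ∧ β / (1 - M.γ) ^ 2 ≤ α / (1 - M.γ) := by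
    have h1 : ∀ n : ℕ, n ≤ 3 → β / (1 - M.γ) ^ n ≤ α := fun n hn =>
      (div_le_div_of_nonneg_left hβ.le (pow_pos hγ 3)
        (pow_le_pow_of_le_one hγ.le (by linarith [M.γ_pos]) hn)).trans hα
    have h2 := h1 1 (by norm_num)
    rw [pow_one] at h2
    refine ⟨h2, ?_⟩
    rw [sq, ← div_div]
    exact div_le_div_of_nonneg_right h2 hγ.le
  have hstep : ∀ k < K, F (M.valueVec ν) - F (M.valueVec (π (k + 1))) ≤
      α / (1 - M.γ) * (D k - D (k + 1)) + α / (1 - M.γ) * (lA / K) := by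
    intro k hk
    have hg : ∑ i, |gradF M.γ F (M.valueVec (softmax (M.arnpgIMD F α η t θ₀ k))) i| ≤ L :=
      hgrad _ ⟨_, rfl⟩
    have hc : 0 < 5 * L * K / (β * lA) := by positivity
    rcases Nat.eq_zero_or_pos (t k) with h0 | h0
    · have hsame : π (k + 1) = π k := by
        rw [hπ, hπ, MOMDP.arnpgIMD, h0]
        rfl
      have h1 : F (M.valueVec ν) - F (M.valueVec (π k)) ≤ L / (1 - M.γ) :=
        M.sub_le_of_gradF hF hsmooth.1 (hpol k) hν.1 (by rw [hπ]; exact hg)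
      -- A zero step count means that the logarithm is not positive. Then `L` is so small that the
      -- crude gap already fits into the error allowance, although the policy does not move.
      have h2 : 5 * L * K / (β * lA) ≤ 1 := by
        have h3 := (ht k hk).symm.trans h0
        rw [Nat.ceil_eq_zero] at h3
        by_contra hlt
        have := mul_pos (one_div_pos.2 hγ) (Real.log_pos (not_le.1 hlt))
        linarith
      rw [div_le_one (by positivity)] at h2
      have h4 : L ≤ α * (lA / K) := by
        rw [← mul_div_assoc, le_div_iff₀ hK0]
        have h5 : β ≤ α := le_trans (by
          rw [le_div_iff₀ hγ]
          nlinarith [M.γ_pos]) hβα.1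
        have h6 : β * lA ≤ α * lA := mul_le_mul_of_nonneg_right h5 hlog.le
        nlinarith [mul_pos hL hK0]
      have h7 := div_le_div_of_nonneg_right h4 hγ.le
      simp only [D, hsame, sub_self, mul_zero, zero_add]
      rw [div_mul_eq_mul_div]
      exact h1.trans h7
    · have hs := M.sub_le_of_innerLoop hF hβ hsmooth hα (M.arnpgIMD F α η t θ₀ k) hg h0 hν.1
        (θ' := M.arnpgIMD F α η t θ₀ (k + 1)) (by rw [MOMDP.arnpgIMD, hη])
      rw [← hπ, ← hπ] at hs
      refine hs.trans (add_le_add le_rfl ?_)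
      have h1 : M.γ ^ t k ≤ (5 * L * K / (β * lA))⁻¹ := by
        refine pow_le_inv_of_log_le M.γ_pos M.γ_lt_one hc ?_
        rw [ht k hk]
        refine le_trans ?_ (Nat.le_ceil _)
        exact le_add_of_nonneg_right zero_le_one
      calc M.γ ^ t k * (2 * L / (1 - M.γ) ^ 2)
          ≤ (5 * L * K / (β * lA))⁻¹ * (2 * L / (1 - M.γ) ^ 2) :=
            mul_le_mul_of_nonneg_right h1 (by positivity)
        -- The 2 comes from the initial inner gap, the 5 from the step count; the factor `2 / 5` is
        -- slack.
        _ = 2 / 5 * (β / (1 - M.γ) ^ 2 * (lA / K)) := by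
            have : lA ≠ 0 := hlog.ne'
            field_simp
        _ ≤ β / (1 - M.γ) ^ 2 * (lA / K) :=
            mul_le_of_le_one_left (by positivity) (by norm_num)
        _ ≤ α / (1 - M.γ) * (lA / K) :=
            mul_le_mul_of_nonneg_right hβα.2 (by positivity)
  have hsum := Finset.sum_le_sum fun k hk => hstep k (Finset.mem_range.1 hk)
  rw [Finset.sum_add_distrib, ← Finset.mul_sum, Finset.sum_range_sub', Finset.sum_sub_distrib,
    Finset.sum_const, Finset.sum_const, Finset.card_range, nsmul_eq_mul, nsmul_eq_mul] at hsum
  have hD0 : D 0 ≤ lA := by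
    calc D 0 ≤ ∑ s, M.stateVisit ν s * lA := by
          refine Finset.sum_le_sum fun s _ => mul_le_mul_of_nonneg_left ?_
            (M.stateVisit_nonneg hν.1 s)
          exact klVec_le_log_card (hν.1 s) fun a => by rw [hπ]; exact hθ₀ s a
      _ = lA := by rw [← Finset.sum_mul, M.sum_stateVisit hν.1, one_mul]
  have hDK : 0 ≤ D K := M.policyKL_stateVisit_nonneg hν.1 hν.1 (hpol K) (hpos K)
  have hD : α / (1 - M.γ) * (D 0 - D K) ≤ α / (1 - M.γ) * lA :=
    mul_le_mul_of_nonneg_left (by linarith) (by positivity)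
  have hE : (K : ℝ) * (α / (1 - M.γ) * (lA / K)) = α / (1 - M.γ) * lA := by
    field_simp
  have hIcc : ∑ k ∈ Finset.Icc 1 K, F (M.valueVec (π k)) =
      ∑ k ∈ Finset.range K, F (M.valueVec (π (k + 1))) := by
    rw [Finset.range_eq_Ico, Finset.sum_Ico_add' (fun k => F (M.valueVec (π k))) 0 K 1]
    rfl
  have hfin : F (M.valueVec ν) - 1 / (K : ℝ) * ∑ k ∈ Finset.Icc 1 K, F (M.valueVec (π k)) =
      (K * F (M.valueVec ν) - ∑ k ∈ Finset.range K, F (M.valueVec (π (k + 1)))) / K := by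
    rw [hIcc]
    field_simp
  rw [hfin, ← div_div]
  refine div_le_div_of_nonneg_right ?_ hK0.le
  -- One half pays for the initial divergence, the other for the `K` inner-loop errors.
  have hR : 2 * α * lA / (1 - M.γ) = α / (1 - M.γ) * lA + α / (1 - M.γ) * lA := by ring
  change _ ≤ 2 * α * lA / (1 - M.γ)
  linarith
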